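/- **Definitions.** For a small category $\mathcal A$, the wreath product $\Delta\wr\mathcal A$ has as objects the tuples $(A_1,\dots,A_m)$, $m\ge 0$, of objects of $\mathcal A$; an operator $(A_1,\dots,A_m)\to(B_1,\dots,B_p)$ consists of a $\Delta$-operator $\phi:[m]\to[p]$ and of morphisms $\phi_i^k:A_i\to B_k$ of $\mathcal A$, one for each pair $(i,k)$ with $\phi(i-1)<k\le\phi(i)$; composition is induced by composition in $\Delta$ and $\mathcal A$. Put $\Theta_1=\Delta$ and $\Theta_n=\Delta\wr\Theta_{n-1}$ for $n\ge 2$. A combinatorial $n$-disk $D$ consists of sets $D_0,\dots,D_n$ and maps $i_k:D_k\to D_{k-1}$ and $s_k,t_k:D_{k-1}\to D_k$ ($1\le k\le n$), together with a linear order on each fiber of each $i_k$, such that: $D_0$ is a singleton; $i_ks_k=i_kt_k=\mathrm{id}$; $t_{k+1}t_k=s_{k+1}t_k$ and $t_{k+1}s_k=s_{k+1}s_k$; for each $x\in D_{k-1}$ the fiber $i_k^{-1}(x)$ has minimum $s_k(x)$ and maximum $t_k(x)$; the equalizer of $(s_k,t_k)$ is empty for $k=1$, and is $s_{k-1}(D_{k-2})\cup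 t_{k-1}(D_{k-2})$ for $2\le k\le n$. Maps of $n$-disks are families of maps commuting with all $i_k,s_k,t_k$ and preserving the orders of the fibers. $D$ is finite if all the $D_k$ are; $\mathcal D_n$ denotes the category of finite combinatorial $n$-disks. A functor $F:\Theta_n\to\mathbf{Sets}$ is flat if its left Kan extension $\widehat{\Theta}_n\to\mathbf{Sets}$ along the Yoneda embedding is left exact, where $\widehat\Theta_n=\mathbf{Sets}^{\Theta_n^{\mathrm{op}}}$. Let $\bar 0$ be the empty tuple ($[0]$ in $\Delta$) and let $\bar k\in\Theta_n$ ($1\le k\le n$) be the one-term tuple on $\overline{k-1}\in\Theta_{n-1}$ ($[1]$ in $\Delta$ if $n=1$). Let $\overline{k-1}\rightrightarrows\bar k\to\overline{k-1}$ be the operators which, under the outer $k-1$ one-term tuples, are given by the vertices $0,1:[0]\rightrightarrows[1]$ and by $[1]\to[0]$. Let $\bar k'$ be obtained from $\bar k$ by replacing its innermost $[1]$ by $[2]$. For a functor $F:\Theta_n\to\mathbf{Sets}$, its restriction to linear level-trees $RF$ consists of the sets $F(\bar k)$, of the maps $s_k,t_k,i_k$ induced by these three operators, and of the relation on $F(\bar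 k)$, $k\ge1$, which is the image of $F(\bar k')\to F(\bar k)\times F(\bar k)$ induced by the degeneracies $s_0,s_1:[2]\rightrightarrows[1]$ (where $s_j$ takes the value $j$ twice). **Theorem.** Let $n\ge 1$. 1. The presheaf topos $\widehat{\Theta}_n$ is a classifying topos for combinatorial $n$-disks: if $F:\Theta_n\to\mathbf{Sets}$ is flat, then $RF$ is a combinatorial $n$-disk, and $F\mapsto RF$ is an equivalence from the category of flat functors $\Theta_n\to\mathbf{Sets}$ (and natural transformations) to the category of combinatorial $n$-disks. 2. In particular, the dual of $\Theta_n$ is isomorphic to (a skeleton of) Joyal's category $\mathcal D_n$: the functor $T\mapsto R\,\Theta_n(T,-)$ takes values in finite combinatorial $n$-disks and is an equivalence of categories $\Theta_n^{\mathrm{op}}\to\mathcal D_n$, and isomorphic objects of $\Theta_n$ are equal. -/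

import Mathlib

open CategoryTheory

universe w v u

/-- For `φ : [m] ⟶ [n]` in `Δ`, with the factors numbered from `0`: the index `k` belongs to
the block `φ(i) ≤ k < φ(i + 1)` attached to `i`. (Numbering from `1` this is the condition
`φ(i - 1) < k ≤ φ(i)`.) -/
def InBlock {m n : ℕ} (φ : SimplexCategory.mk m ⟶ SimplexCategory.mk n) (i : Fin m) (k : Fin n) :
    Prop :=
  φ.toOrderHom i.castSucc ≤ k.castSucc ∧ k.castSucc < φ.toOrderHom i.succ

theorem InBlock.unique {m n : ℕ} {φ : (SimplexCategory.mk m) ⟶ SimplexCategory.mk n} {i j : Fin m} {k : Fin n}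
    (hi : InBlock φ i k) (hj : InBlock φ j k) : i = j := by
  rcases lt_trichotomy i j with h | h | h
  · have := φ.toOrderHom.monotone (Fin.succ_le_castSucc_iff.2 h)
    exact absurd ((hi.2.trans_le this).trans_le hj.1) (lt_irrefl _)
  · exact h
  · have := φ.toOrderHom.monotone (Fin.succ_le_castSucc_iff.2 h)
    exact absurd ((hj.2.trans_le this).trans_le hi.1) (lt_irrefl _)

theorem inBlock_id {m : ℕ} {i k : Fin m} :
    InBlock (𝟙 (SimplexCategory.mk m)) i k ↔ i = k := by
  simp only [InBlock, SimplexCategory.id_toOrderHom, OrderHom.id_coe, id, Fin.le_def, Fin.lt_def,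
    Fin.ext_iff, Fin.val_castSucc, Fin.val_succ]
  omega

theorem InBlock.exists_mid {m n p : ℕ} {φ : (SimplexCategory.mk m) ⟶ SimplexCategory.mk n}
    {ψ : (SimplexCategory.mk n) ⟶ SimplexCategory.mk p} {i : Fin m} {k : Fin p} (h : InBlock (φ ≫ ψ) i k) :
    ∃ j, InBlock φ i j ∧ InBlock ψ j k := by
  have key : ∀ a b : Fin (n + 1), ψ.toOrderHom a ≤ k.castSucc → k.castSucc < ψ.toOrderHom b →
      ∃ j : Fin n, (a ≤ j.castSucc ∧ j.castSucc < b) ∧ InBlock ψ j k := by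
    intro a b ha
    induction b using Fin.induction with
    | zero =>
      intro hb
      exact absurd ((hb.trans_le (ψ.toOrderHom.monotone (Fin.zero_le a))).trans_le ha)
        (lt_irrefl _)
    | succ j ih =>
      intro hb
      by_cases hj : k.castSucc < ψ.toOrderHom j.castSucc
      · obtain ⟨j', ⟨h1, h2⟩, h3⟩ := ih hj
        exact ⟨j', ⟨h1, h2.trans j.castSucc_lt_succ⟩, h3⟩
      · refine ⟨j, ⟨?_, j.castSucc_lt_succ⟩, not_lt.1 hj, hb⟩
        by_contra hlt
        exact absurd ((hb.trans_le
          (ψ.toOrderHom.monotone (Fin.castSucc_lt_iff_succ_le.1 (not_le.1 hlt)))).trans_le ha)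
          (lt_irrefl _)
  obtain ⟨j, h1, h2⟩ := key _ _ h.1 h.2
  exact ⟨j, h1, h2⟩

theorem InBlock.comp {m n p : ℕ} {φ : (SimplexCategory.mk m) ⟶ SimplexCategory.mk n}
    {ψ : (SimplexCategory.mk n) ⟶ SimplexCategory.mk p} {i : Fin m} {j : Fin n} {k : Fin p}
    (h : InBlock φ i j) (h' : InBlock ψ j k) : InBlock (φ ≫ ψ) i k :=
  ⟨(ψ.toOrderHom.monotone h.1).trans h'.1,
    h'.2.trans_le (ψ.toOrderHom.monotone (Fin.castSucc_lt_iff_succ_le.1 h.2))⟩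

/-- Objects of the wreath product `Δ ≀ A`: finite tuples `(A₁, …, A_m)`, `m ≥ 0`. -/
structure WreathDelta (A : Type u) where
  len : ℕ
  obj : Fin len → A

namespace WreathDelta

/-- An operator `(φ; φ₁, …, φ_m) : (A₁, …, A_m) ⟶ (B₁, …, B_n)`: each `φᵢ` is given by its
components `φᵢᵏ : Aᵢ ⟶ B_k`, one for each `k` in the block of `i`. -/
structure Hom {A : Type u} [Category.{v} A] (X Y : WreathDelta A) where
  base : SimplexCategory.mk X.len ⟶ SimplexCategory.mk Y.len
  component : ∀ i k, InBlock base i k → (X.obj i ⟶ Y.obj k)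

variable {A : Type u} [Category.{v} A]

theorem Hom.ext' {X Y : WreathDelta A} {f g : Hom X Y} (h : f.base = g.base)
    (h' : ∀ i k hf hg, f.component i k hf = g.component i k hg) : f = g := by
  obtain ⟨φ, c⟩ := f
  obtain ⟨ψ, d⟩ := g
  obtain rfl : φ = ψ := h
  congr
  funext i k hk
  exact h' i k hk hk

/-- The identity operator: the components are identities. -/
def Hom.id (X : WreathDelta A) : Hom X X where
  base := 𝟙 _
  component _ _ h := eqToHom (congrArg X.obj (inBlock_id.1 h))

/-- Composition: the `(i, k)` component is `φᵢʲ ≫ ψⱼᵏ`, where `j` is the unique index such that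
`j` lies in the block of `i` and `k` lies in the block of `j`. -/
noncomputable def Hom.comp {X Y Z : WreathDelta A} (f : Hom X Y) (g : Hom Y Z) : Hom X Z where
  base := f.base ≫ g.base
  component i k h :=
    f.component i h.exists_mid.choose h.exists_mid.choose_spec.1 ≫
      g.component h.exists_mid.choose k h.exists_mid.choose_spec.2

theorem Hom.comp_component {X Y Z : WreathDelta A} (f : Hom X Y) (g : Hom Y Z) {i j k}
    (h : InBlock (f.base ≫ g.base) i k) (h₁ : InBlock f.base i j) (h₂ : InBlock g.base j k) :
    (f.comp g).component i k h = f.component i j h₁ ≫ g.component j k h₂ := by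
  obtain rfl : j = h.exists_mid.choose := h₂.unique h.exists_mid.choose_spec.2
  rfl

noncomputable instance : Category.{v} (WreathDelta A) where
  Hom := Hom
  id := Hom.id
  comp := Hom.comp
  id_comp {X Y} f := by
    refine Hom.ext' (Category.id_comp _) fun i k h h' => ?_
    rw [Hom.comp_component (Hom.id X) f h (inBlock_id.2 rfl) h']
    exact Category.id_comp _
  comp_id {X Y} f := by
    refine Hom.ext' (Category.comp_id _) fun i k h h' => ?_
    rw [Hom.comp_component f (Hom.id Y) h h' (inBlock_id.2 rfl)]
    exact Category.comp_id _
  assoc {W X Y Z} f g h := by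
    refine Hom.ext' (Category.assoc _ _ _) fun i l p q => ?_
    obtain ⟨k, p₁, hk⟩ := InBlock.exists_mid (φ := f.base ≫ g.base) (ψ := h.base) p
    obtain ⟨j, hi, hj⟩ := p₁.exists_mid
    rw [Hom.comp_component (f.comp g) h p p₁ hk, Hom.comp_component f g p₁ hi hj,
      Hom.comp_component f (g.comp h) q hi (hj.comp hk), Hom.comp_component g h _ hj hk,
      Category.assoc]

end WreathDelta

/-- The category `Θ_n`: `Θ₁ = Δ` and `Θ_n = Δ ≀ Θ_{n-1}` for `n ≥ 2`. (The value at `0`, the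
one-point category, is only a convention.) -/
noncomputable def Theta : ℕ → Cat.{0, 0}
  | 0 => Cat.of (Discrete PUnit)
  | 1 => Cat.of SimplexCategory
  | n + 2 => Cat.of (WreathDelta (Theta (n + 1)))

namespace Theta

/-- The linear level-tree of height `k`, for `k ≤ n`: the empty tuple (`[0]` in `Δ`) for `k = 0`,
and the one-term tuple on the linear level-tree of height `k - 1` (`[1]` in `Δ`) for `k > 0`.
(For `k > n` the value is the linear level-tree of height `n`; it is not used.) -/
noncomputable def lin : ∀ n : ℕ, ℕ → Theta n
  | 0, _ => (⟨⟨⟩⟩ : Discrete PUnit)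
  | 1, 0 => (SimplexCategory.mk 0)
  | 1, _ + 1 => (SimplexCategory.mk 1)
  | n + 2, 0 => (⟨0, Fin.elim0⟩ : WreathDelta (Theta (n + 1)))
  | n + 2, k + 1 => (⟨1, fun _ => lin (n + 1) k⟩ : WreathDelta (Theta (n + 1)))

/-- The level-tree consisting of the linear level-tree of height `k` with two edges attached to
its top vertex, for `k < n`. (The values for `k ≥ n` are not used.) -/
noncomputable def fork : ∀ n : ℕ, ℕ → Theta n
  | 0, _ => (⟨⟨⟩⟩ : Discrete PUnit)
  | 1, 0 => (SimplexCategory.mk 2)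
  | 1, _ + 1 => (SimplexCategory.mk 1)
  | n + 2, 0 => (⟨2, fun _ => lin (n + 1) 0⟩ : WreathDelta (Theta (n + 1)))
  | n + 2, k + 1 => (⟨1, fun _ => fork (n + 1) k⟩ : WreathDelta (Theta (n + 1)))

/-- The operator `(id; f) : (A) ⟶ (B)` of `Δ ≀ A` between one-term tuples. -/
def single {A : Type u} [Category.{v} A] {X Y : A} (f : X ⟶ Y) :
    (⟨1, fun _ => X⟩ : WreathDelta A) ⟶ ⟨1, fun _ => Y⟩ :=
  show WreathDelta.Hom _ _ from { base := 𝟙 _, component := fun _ _ _ => f }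

/-- The source operator between linear level-trees: the vertex `0 : [0] ⟶ [1]` of `Δ` at the
top level. -/
noncomputable def src : ∀ n k : ℕ, lin n k ⟶ lin n (k + 1)
  | 0, _ => 𝟙 (⟨⟨⟩⟩ : Discrete PUnit)
  | 1, 0 => (SimplexCategory.δ 1 : (SimplexCategory.mk 0) ⟶ SimplexCategory.mk 1)
  | 1, _ + 1 => 𝟙 (SimplexCategory.mk 1)
  | n + 2, 0 => show WreathDelta.Hom (A := Theta (n + 1)) ⟨0, Fin.elim0⟩ ⟨1, fun _ => lin (n + 1) 0⟩
      from { base := SimplexCategory.δ 1, component := fun i => i.elim0 }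
  | n + 2, k + 1 => single (src (n + 1) k)

/-- The target operator between linear level-trees: the vertex `1 : [0] ⟶ [1]` of `Δ` at the
top level. -/
noncomputable def tgt : ∀ n k : ℕ, lin n k ⟶ lin n (k + 1)
  | 0, _ => 𝟙 (⟨⟨⟩⟩ : Discrete PUnit)
  | 1, 0 => (SimplexCategory.δ 0 : (SimplexCategory.mk 0) ⟶ SimplexCategory.mk 1)
  | 1, _ + 1 => 𝟙 (SimplexCategory.mk 1)
  | n + 2, 0 => show WreathDelta.Hom (A := Theta (n + 1)) ⟨0, Fin.elim0⟩ ⟨1, fun _ => lin (n + 1) 0⟩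
      from { base := SimplexCategory.δ 0, component := fun i => i.elim0 }
  | n + 2, k + 1 => single (tgt (n + 1) k)

/-- The operator between linear level-trees collapsing the top edge: `[1] ⟶ [0]` of `Δ` at the
top level. -/
noncomputable def proj : ∀ n k : ℕ, lin n (k + 1) ⟶ lin n k
  | 0, _ => 𝟙 (⟨⟨⟩⟩ : Discrete PUnit)
  | 1, 0 => (SimplexCategory.σ 0 : (SimplexCategory.mk 1) ⟶ SimplexCategory.mk 0)
  | 1, _ + 1 => 𝟙 (SimplexCategory.mk 1)
  | n + 2, 0 => show WreathDelta.Hom (A := Theta (n + 1)) ⟨1, fun _ => lin (n + 1) 0⟩ ⟨0, Fin.elim0⟩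
      from { base := SimplexCategory.σ 0, component := fun _ k => k.elim0 }
  | n + 2, k + 1 => single (proj (n + 1) k)

/-- The degeneracy `s_0 : [2] ⟶ [1]` of `Δ` at the top level. -/
noncomputable def deg₀ : ∀ n k : ℕ, fork n k ⟶ lin n (k + 1)
  | 0, _ => 𝟙 (⟨⟨⟩⟩ : Discrete PUnit)
  | 1, 0 => (SimplexCategory.σ 0 : (SimplexCategory.mk 2) ⟶ SimplexCategory.mk 1)
  | 1, _ + 1 => 𝟙 (SimplexCategory.mk 1)
  | n + 2, 0 => show WreathDelta.Hom (A := Theta (n + 1))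
        ⟨2, fun _ => lin (n + 1) 0⟩ ⟨1, fun _ => lin (n + 1) 0⟩
      from { base := SimplexCategory.σ 0, component := fun _ _ _ => 𝟙 _ }
  | n + 2, k + 1 => single (deg₀ (n + 1) k)

/-- The degeneracy `s_1 : [2] ⟶ [1]` of `Δ` at the top level. -/
noncomputable def deg₁ : ∀ n k : ℕ, fork n k ⟶ lin n (k + 1)
  | 0, _ => 𝟙 (⟨⟨⟩⟩ : Discrete PUnit)
  | 1, 0 => (SimplexCategory.σ 1 : (SimplexCategory.mk 2) ⟶ SimplexCategory.mk 1)
  | 1, _ + 1 => 𝟙 (SimplexCategory.mk 1)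
  | n + 2, 0 => show WreathDelta.Hom (A := Theta (n + 1))
        ⟨2, fun _ => lin (n + 1) 0⟩ ⟨1, fun _ => lin (n + 1) 0⟩
      from { base := SimplexCategory.σ 1, component := fun _ _ _ => 𝟙 _ }
  | n + 2, k + 1 => single (deg₁ (n + 1) k)

end Theta

/-- The data underlying a combinatorial `n`-disk: sets `D_0, …, D_n`, maps `i : D_{k+1} → D_k` and
`s, t : D_k → D_{k+1}`, and a relation `≤` on each `D_{k+1}` (to be an ordering of the fibers
of `i`). -/
structure DiskData (n : ℕ) where
  cell : ∀ k, k ≤ n → Type w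
  i : ∀ k (h : k < n), cell (k + 1) h → cell k h.le
  s : ∀ k (h : k < n), cell k h.le → cell (k + 1) h
  t : ∀ k (h : k < n), cell k h.le → cell (k + 1) h
  le : ∀ k (h : k < n), cell (k + 1) h → cell (k + 1) h → Prop

namespace DiskData

variable {n : ℕ}

/-- Maps commute with `i`, `s`, `t` and preserve the relations `≤`. -/
@[ext]
structure Hom (D E : DiskData.{w} n) where
  app : ∀ k (h : k ≤ n), D.cell k h → E.cell k h
  app_i : ∀ k (h : k < n) x, app k h.le (D.i k h x) = E.i k h (app (k + 1) h x)
  app_s : ∀ k (h : k < n) x, app (k + 1) h (D.s k h x) = E.s k h (app k h.le x)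
  app_t : ∀ k (h : k < n) x, app (k + 1) h (D.t k h x) = E.t k h (app k h.le x)
  app_le : ∀ k (h : k < n) x y, D.le k h x y → E.le k h (app (k + 1) h x) (app (k + 1) h y)

instance : Category (DiskData.{w} n) where
  Hom := Hom
  id D := ⟨fun _ _ x => x, fun _ _ _ => rfl, fun _ _ _ => rfl, fun _ _ _ => rfl,
    fun _ _ _ _ h => h⟩
  comp f g := ⟨fun k h x => g.app k h (f.app k h x),
    fun k h x => by rw [f.app_i, g.app_i], fun k h x => by rw [f.app_s, g.app_s],
    fun k h x => by rw [f.app_t, g.app_t],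
    fun k h x y p => g.app_le k h _ _ (f.app_le k h x y p)⟩

/-- The axioms of a combinatorial `n`-disk. -/
structure IsDisk (D : DiskData.{w} n) : Prop where
  cell_zero : Nonempty (Unique (D.cell 0 (Nat.zero_le n)))
  i_s : ∀ k (h : k < n) x, D.i k h (D.s k h x) = x
  i_t : ∀ k (h : k < n) x, D.i k h (D.t k h x) = x
  t_t : ∀ k (h : k + 1 < n) x,
    D.t (k + 1) h (D.t k (Nat.lt_of_succ_lt h) x) = D.s (k + 1) h (D.t k (Nat.lt_of_succ_lt h) x)
  t_s : ∀ k (h : k + 1 < n) x,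
    D.t (k + 1) h (D.s k (Nat.lt_of_succ_lt h) x) = D.s (k + 1) h (D.s k (Nat.lt_of_succ_lt h) x)
  /-- Only elements of the same fiber of `i` are compared. -/
  le_fiber : ∀ k (h : k < n) x y, D.le k h x y → D.i k h x = D.i k h y
  /-- Each fiber is linearly ordered. -/
  le_refl : ∀ k (h : k < n) x, D.le k h x x
  le_trans : ∀ k (h : k < n) x y z, D.le k h x y → D.le k h y z → D.le k h x z
  le_antisymm : ∀ k (h : k < n) x y, D.le k h x y → D.le k h y x → x = y
  le_total : ∀ k (h : k < n) x y, D.i k h x = D.i k h y → D.le k h x y ∨ D.le k h y x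
  /-- `s x` and `t x` are the minimum and the maximum of the fiber over `x`. -/
  s_le : ∀ k (h : k < n) x y, D.i k h y = x → D.le k h (D.s k h x) y
  le_t : ∀ k (h : k < n) x y, D.i k h y = x → D.le k h y (D.t k h x)
  /-- The equalizer of `s, t : D_0 → D_1` is empty. -/
  equalizer_zero : ∀ h : 0 < n, {x | D.s 0 h x = D.t 0 h x} = ∅
  /-- The equalizer of `s, t : D_{k+1} → D_{k+2}` is the union `s(D_k) ∪ t(D_k)`. -/
  equalizer_succ : ∀ k (h : k + 1 < n), {x | D.s (k + 1) h x = D.t (k + 1) h x} =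
    Set.range (D.s k (Nat.lt_of_succ_lt h)) ∪ Set.range (D.t k (Nat.lt_of_succ_lt h))

/-- A combinatorial `n`-disk all of whose sets are finite. -/
structure IsFiniteDisk (D : DiskData.{w} n) : Prop extends IsDisk D where
  finite : ∀ k (h : k ≤ n), Finite (D.cell k h)

end DiskData

/-- The category of combinatorial `n`-disks. -/
abbrev CombDisk (n : ℕ) := ObjectProperty.FullSubcategory (DiskData.IsDisk.{w} (n := n))

/-- The category `𝒟_n` of finite combinatorial `n`-disks. -/
abbrev FinCombDisk (n : ℕ) := ObjectProperty.FullSubcategory (DiskData.IsFiniteDisk.{w} (n := n))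

/-- A functor `F : A ⥤ Sets` on a small category is flat if its left Kan extension along the
Yoneda embedding, `(-) ⊗_A F : (Aᵒᵖ ⥤ Sets) ⥤ Sets`, is left exact. -/
def IsFlat {A : Type} [SmallCategory A] (F : A ⥤ Type w) : Prop :=
  Limits.PreservesFiniteLimits (uliftYoneda.{w}.leftKanExtension F)

/-- The category of flat functors `Θ_n ⥤ Sets`. -/
abbrev FlatTheta (n : ℕ) := ObjectProperty.FullSubcategory fun F : Theta n ⥤ Type w => IsFlat F

/-- Restriction of a functor `Θ_n ⥤ Sets` to the linear level-trees, with the relation `≤` on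
`D_{k+1}` induced by the pair of degeneracies `s_0, s_1`. -/
noncomputable def restrictLin (n : ℕ) : (Theta n ⥤ Type w) ⥤ DiskData.{w} n where
  obj F :=
    { cell := fun k _ => F.obj (Theta.lin n k)
      i := fun k _ => F.map (Theta.proj n k)
      s := fun k _ => F.map (Theta.src n k)
      t := fun k _ => F.map (Theta.tgt n k)
      le := fun k _ x y => ∃ z, F.map (Theta.deg₀ n k) z = x ∧ F.map (Theta.deg₁ n k) z = y }
  map {F G} α := show DiskData.Hom _ _ from
    { app := fun k _ => α.app (Theta.lin n k)
      app_i := fun k _ x => NatTrans.naturality_apply α _ x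
      app_s := fun k _ x => NatTrans.naturality_apply α _ x
      app_t := fun k _ x => NatTrans.naturality_apply α _ x
      app_le := by
        rintro k _ _ _ ⟨z, rfl, rfl⟩
        exact ⟨α.app _ z, (NatTrans.naturality_apply α _ z).symm,
          (NatTrans.naturality_apply α _ z).symm⟩ }

/-!
The theorem rests on a duality between `Θ_n` and the finite `n`-disks.

For an object `T` of a category `A` with a `DiskShape` (images of the linear level-trees and forks),
the operators from `T` into the shape form an `n`-disk datum, the *nerve* of `T`. The shape is a
*duality* if `T ↦ nerve T` is a contravariant equivalence between `A` and finite `n`-disks.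
A duality for `A` in dimension `n` yields one for `Δ ≀ A` in dimension `n + 1`
(`DiskShape.IsDuality.wreath`): an operator from `(A₁, …, A_m)` to a one-term tuple `(B)` is either
constant on one of the two vertices of `[1]`, or it jumps at a unique index `i`, and then it is an
operator `A_i ⟶ B`. So the nerve of the tuple has `m` inner cells of dimension one, and the part
lying over the `i`-th of them is the nerve of `A_i`; everything over the two outer cells is
degenerate. Conversely, a finite `(n + 1)`-disk is determined by the finite linear order of its
inner cells of dimension one and by the `n`-disks lying over them. Since `Θ_1 = Δ` is equivalent
to `Δ ≀ Θ_0`, induction gives the duality for all `Θ_n` (`Theta.isDuality_shape`), which is the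
second half of the theorem, together with the fact that `Θ_n` is skeletal (`Theta.skeletal`).

For the first half, a functor is flat if and only if its category of elements is cofiltered
(`isFlat_of_isCofiltered`, `IsFlat.isCofiltered`), so it is a filtered colimit of corepresentable
functors. The axioms of disks only involve finitely many cells at a time, so the restriction of a
flat functor is a filtered colimit of finite disks and hence a disk
(`DiskShape.isDisk_restrict`); the duality and the finiteness of nerves imply that elements of
`F T` are maps from the nerve of `T` to the restriction of `F` (`DiskShape.ofElement_bijective`).
This shows that restriction is fully faithful. Finally, every disk `D` is the directed union of its
finite subdisks (`DiskData.exists_finite_subdisk`), which are nerves, so the functor of maps from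
nerves to `D` is flat (`DiskShape.isCofiltered_homNerve`) and restricts to `D`
(`DiskShape.isIso_evalId`).
-/

/-! ### Disks of operators into a shape, and operators of `Δ ≀ A` -/

/-- The shape of an `n`-disk in a category `A`: the images of the linear level-trees, of the
level-trees with one fork at the top, and of the operators between them. No equations are
imposed; only the disks obtained by mapping into the shape matter. -/
structure DiskShape (A : Type u) [Category.{v} A] where
  lin : ℕ → A
  fork : ℕ → A
  proj : ∀ k, lin (k + 1) ⟶ lin k
  src : ∀ k, lin k ⟶ lin (k + 1)
  tgt : ∀ k, lin k ⟶ lin (k + 1)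
  deg₀ : ∀ k, fork k ⟶ lin (k + 1)
  deg₁ : ∀ k, fork k ⟶ lin (k + 1)

namespace DiskShape

theorem ext_of_heq {A : Type u} [Category.{v} A] {X Y : DiskShape A}
    (lin : ∀ k, X.lin k = Y.lin k) (fork : ∀ k, X.fork k = Y.fork k)
    (proj : ∀ k, X.proj k ≍ Y.proj k) (src : ∀ k, X.src k ≍ Y.src k)
    (tgt : ∀ k, X.tgt k ≍ Y.tgt k) (deg₀ : ∀ k, X.deg₀ k ≍ Y.deg₀ k)
    (deg₁ : ∀ k, X.deg₁ k ≍ Y.deg₁ k) : X = Y := by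
  obtain ⟨l, f, p, s, t, d, e⟩ := X
  obtain ⟨l', f', p', s', t', d', e'⟩ := Y
  obtain rfl : l = l' := funext lin
  obtain rfl : f = f' := funext fork
  obtain rfl : p = p' := funext fun k => eq_of_heq (proj k)
  obtain rfl : s = s' := funext fun k => eq_of_heq (src k)
  obtain rfl : t = t' := funext fun k => eq_of_heq (tgt k)
  obtain rfl : d = d' := funext fun k => eq_of_heq (deg₀ k)
  obtain rfl : e = e' := funext fun k => eq_of_heq (deg₁ k)
  rfl

variable {A : Type u} [Category.{0} A] (X : DiskShape A)

/-- The `n`-disk of operators from `T` into the shape, i.e. the restriction to the shape of the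
functor corepresented by `T`. -/
def nerve (n : ℕ) (T : A) : DiskData.{w} n where
  cell k _ := ULift.{w} (T ⟶ X.lin k)
  i k _ x := ⟨x.down ≫ X.proj k⟩
  s k _ x := ⟨x.down ≫ X.src k⟩
  t k _ x := ⟨x.down ≫ X.tgt k⟩
  le k _ x y := ∃ z : ULift.{w} (T ⟶ X.fork k),
    ULift.up (z.down ≫ X.deg₀ k) = x ∧ ULift.up (z.down ≫ X.deg₁ k) = y

/-- Precomposition with `f`. -/
def nerveMap (n : ℕ) {S T : A} (f : S ⟶ T) : X.nerve.{w} n T ⟶ X.nerve.{w} n S :=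
  show DiskData.Hom _ _ from
  { app := fun _ _ x => ⟨f ≫ x.down⟩
    app_i := fun _ _ _ => congrArg ULift.up (Category.assoc _ _ _).symm
    app_s := fun _ _ _ => congrArg ULift.up (Category.assoc _ _ _).symm
    app_t := fun _ _ _ => congrArg ULift.up (Category.assoc _ _ _).symm
    app_le := by
      rintro k _ _ _ ⟨z, rfl, rfl⟩
      exact ⟨⟨f ≫ z.down⟩, congrArg ULift.up (Category.assoc _ _ _),
        congrArg ULift.up (Category.assoc _ _ _)⟩ }

/-- The assignment `T ↦ X.nerve n T` is a duality between `A` and the finite `n`-disks. -/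
structure IsDuality (n : ℕ) : Prop where
  isFiniteDisk : ∀ T, (X.nerve.{w} n T).IsFiniteDisk
  faithful : ∀ {S T : A} (f g : S ⟶ T),
    (∀ k, k ≤ n → ∀ x : T ⟶ X.lin k, f ≫ x = g ≫ x) → f = g
  full : ∀ {S T : A} (φ : X.nerve.{w} n T ⟶ X.nerve.{w} n S), ∃ f : S ⟶ T, X.nerveMap n f = φ
  essSurj : ∀ D : DiskData.{w} n, D.IsFiniteDisk → ∃ T, Nonempty (X.nerve n T ≅ D)

end DiskShape

theorem SimplexCategory.hom_ext_apply {m n : ℕ} {f g : SimplexCategory.mk m ⟶ SimplexCategory.mk n}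
    (h : ∀ a, f.toOrderHom a = g.toOrderHom a) : f = g :=
  SimplexCategory.Hom.ext _ _ (OrderHom.ext _ _ (funext h))

/-- The operator `[m] ⟶ [1]` which jumps from `0` to `1` between `j` and `j + 1`. -/
def cut {m : ℕ} (j : Fin m) : SimplexCategory.mk m ⟶ SimplexCategory.mk 1 :=
  SimplexCategory.mkHom ⟨fun a => if j.castSucc < a then 1 else 0, fun a b h => by
    dsimp only
    split_ifs with h1 h2
    · exact le_rfl
    · exact absurd (h1.trans_le h) h2
    · exact Fin.zero_le _
    · exact le_rfl⟩

theorem cut_apply {m : ℕ} (j : Fin m) (a : Fin (m + 1)) :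
    (cut j).toOrderHom a = if j.castSucc < a then 1 else 0 := rfl

theorem comp_cut_apply {m p : ℕ} (φ : SimplexCategory.mk p ⟶ SimplexCategory.mk m) (j : Fin m)
    (a : Fin (p + 1)) :
    (φ ≫ cut j).toOrderHom a = if j.castSucc < φ.toOrderHom a then 1 else 0 := rfl

theorem inBlock_one {m : ℕ} {β : SimplexCategory.mk m ⟶ SimplexCategory.mk 1} {i : Fin m}
    {k : Fin 1} :
    InBlock β i k ↔ β.toOrderHom i.castSucc = 0 ∧ β.toOrderHom i.succ = 1 := by
  obtain rfl : k = 0 := Subsingleton.elim _ _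
  rw [InBlock]
  refine and_congr ?_ ?_
  · exact Fin.le_zero_iff
  · exact ⟨fun h => Fin.eq_one_of_ne_zero _ h.ne', fun h => h.symm ▸ Fin.zero_lt_one⟩

theorem InBlock.cut_iff {m p : ℕ} {φ : SimplexCategory.mk p ⟶ SimplexCategory.mk m} {i : Fin p}
    {j : Fin m} {k : Fin 1} : InBlock (φ ≫ cut j) i k ↔ InBlock φ i j := by
  rw [inBlock_one, comp_cut_apply, comp_cut_apply, InBlock]
  refine and_congr ?_ ?_ <;> split_ifs with h <;> simp [h]
  exact not_lt.1 h

theorem inBlock_cut {m : ℕ} {i j : Fin m} {k : Fin 1} : InBlock (cut j) i k ↔ i = j := by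
  rw [← inBlock_id, ← InBlock.cut_iff (φ := 𝟙 _) (k := k), Category.id_comp]

/-- An operator `[m] ⟶ [1]` with a nonempty block jumps there. -/
theorem InBlock.eq_cut {m : ℕ} {β : SimplexCategory.mk m ⟶ SimplexCategory.mk 1} {j : Fin m}
    {k : Fin 1} (h : InBlock β j k) : β = cut j := by
  rw [inBlock_one] at h
  refine SimplexCategory.hom_ext_apply fun a => ?_
  rw [cut_apply]
  split_ifs with ha
  · have := β.toOrderHom.monotone (Fin.castSucc_lt_iff_succ_le.1 ha)
    rw [h.2] at this
    exact le_antisymm (Fin.le_last _) this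
  · have := β.toOrderHom.monotone (not_lt.1 ha)
    rw [h.1] at this
    exact le_antisymm this (Fin.zero_le _)

/-- An operator `[m] ⟶ [1]` either jumps somewhere or is constant. -/
theorem exists_inBlock_or_const {m : ℕ} (β : SimplexCategory.mk m ⟶ SimplexCategory.mk 1) :
    (∃ j, InBlock β j 0) ∨ (∀ a, β.toOrderHom a = 0) ∨ ∀ a, β.toOrderHom a = 1 := by
  by_cases h : ∃ j, InBlock β j 0
  · exact Or.inl h
  refine Or.inr ?_
  have h0 : ∀ a, β.toOrderHom a = β.toOrderHom 0 := by
    intro a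
    induction a using Fin.induction with
    | zero => rfl
    | succ j ih =>
      rcases Fin.exists_fin_two.1 ⟨β.toOrderHom 0, rfl⟩ with h1 | h1
      · by_contra hne
        refine h ⟨j, inBlock_one.2 ⟨ih.trans h1, Fin.eq_one_of_ne_zero _ ?_⟩⟩
        rwa [h1] at hne
      · have := β.toOrderHom.monotone (Fin.zero_le j.succ)
        rw [h1] at this ⊢
        exact le_antisymm (Fin.le_last _) this
  rcases Fin.exists_fin_two.1 ⟨β.toOrderHom 0, rfl⟩ with h1 | h1
  · exact Or.inl fun a => (h0 a).trans h1
  · exact Or.inr fun a => (h0 a).trans h1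

namespace WreathDelta

variable {A : Type u} [Category.{v} A]

/-- The one-term tuple on `Y`. -/
abbrev one (Y : A) : WreathDelta A := ⟨1, fun _ => Y⟩

/-- The empty tuple. -/
abbrev zero : WreathDelta A := ⟨0, Fin.elim0⟩

instance (S : WreathDelta A) : Subsingleton (S ⟶ (zero : WreathDelta A)) :=
  ⟨fun _ _ => Hom.ext' (SimplexCategory.hom_ext_apply fun _ => Subsingleton.elim (α := Fin 1) _ _)
    fun _ k => k.elim0⟩

instance (S : WreathDelta A) : Nonempty (S ⟶ (zero : WreathDelta A)) :=
  ⟨show Hom _ _ from ⟨SimplexCategory.const _ _ 0, fun _ k => k.elim0⟩⟩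

theorem comp_component {X Y Z : WreathDelta A} (f : X ⟶ Y) (g : Y ⟶ Z) {i j k}
    (h : InBlock (Hom.base (f ≫ g)) i k) (h₁ : InBlock (Hom.base f) i j)
    (h₂ : InBlock (Hom.base g) j k) :
    Hom.component (f ≫ g) i k h = Hom.component f i j h₁ ≫ Hom.component g j k h₂ :=
  Hom.comp_component f g h h₁ h₂

theorem base_comp_single {S : WreathDelta A} {Y Z : A} (f : S ⟶ one Y) (g : Y ⟶ Z) :
    Hom.base (f ≫ Theta.single g) = Hom.base f := Category.comp_id _

theorem component_comp_single {S : WreathDelta A} {Y Z : A} (f : S ⟶ one Y) (g : Y ⟶ Z) (i j)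
    (h : InBlock (Hom.base (f ≫ Theta.single g)) i j) (h' : InBlock (Hom.base f) i j) :
    Hom.component (f ≫ Theta.single g) i j h = Hom.component f i j h' ≫ g :=
  comp_component f (Theta.single g) h h' (inBlock_id.2 rfl)

theorem hom_ext {X Y : WreathDelta A} {f g : X ⟶ Y} (h : Hom.base f = Hom.base g)
    (h' : ∀ i k hf hg, Hom.component f i k hf = Hom.component g i k hg) : f = g :=
  Hom.ext' h h'

theorem component_congr {X Y : WreathDelta A} {f g : X ⟶ Y} (e : f = g) {i k}
    (h : InBlock (Hom.base f) i k) (h' : InBlock (Hom.base g) i k) :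
    Hom.component f i k h = Hom.component g i k h' := by
  subst e
  rfl

theorem comp_single_comp_single {S : WreathDelta A} {X Y Z : A} (x : S ⟶ one X) (f : X ⟶ Y)
    (g : Y ⟶ Z) : (x ≫ Theta.single f) ≫ Theta.single g = x ≫ Theta.single (f ≫ g) := by
  refine hom_ext ((base_comp_single _ g).trans ((base_comp_single x f).trans
    (base_comp_single x (f ≫ g)).symm)) fun i j hf hg => ?_
  have h1 : InBlock (Hom.base (x ≫ Theta.single f)) i j := by rwa [← base_comp_single _ g]
  have h2 : InBlock (Hom.base x) i j := by rwa [← base_comp_single x f]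
  refine (component_comp_single _ g i j hf h1).trans ?_
  refine (congrArg (· ≫ g) (component_comp_single x f i j h1 h2)).trans ?_
  exact (Category.assoc _ _ _).trans (component_comp_single x (f ≫ g) i j hg h2).symm

theorem comp_single_eq_iff {S : WreathDelta A} {Y Z : A} {x : S ⟶ one Y} {f : Y ⟶ Z}
    {z : S ⟶ one Z} : x ≫ Theta.single f = z ↔ Hom.base x = Hom.base z ∧
      ∀ i j h h', Hom.component x i j h ≫ f = Hom.component z i j h' := by
  constructor
  · rintro rfl
    exact ⟨(base_comp_single x f).symm, fun i j h h' => (component_comp_single x f i j h' h).symm⟩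
  · rintro ⟨hb, hc⟩
    refine hom_ext ((base_comp_single x f).trans hb) fun i j hf hg => ?_
    have h2 : InBlock (Hom.base x) i j := by rw [hb]; exact hg
    exact (component_comp_single x f i j hf h2).trans (hc i j h2 hg)

theorem comp_single_eq_comp_single_iff {S : WreathDelta A} {Y Y' Z : A} {x : S ⟶ one Y}
    {f : Y ⟶ Z} {x' : S ⟶ one Y'} {f' : Y' ⟶ Z} :
    x ≫ Theta.single f = x' ≫ Theta.single f' ↔ Hom.base x = Hom.base x' ∧
      ∀ i j h h', Hom.component x i j h ≫ f = Hom.component x' i j h' ≫ f' := by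
  rw [comp_single_eq_iff]
  refine and_congr (by rw [base_comp_single]) ⟨fun h i j hx hx' => ?_, fun h i j hx hx' => ?_⟩
  · rw [h i j hx (by rwa [base_comp_single]), component_comp_single]
  · have h2 : InBlock (Hom.base x') i j := by rwa [← base_comp_single x' f']
    exact (h i j hx h2).trans (component_comp_single x' f' i j hx' h2).symm

/-- A morphism to a one-term tuple without components is determined by its underlying operator. -/
theorem hom_ext_of_const {X : WreathDelta A} {Y : A} {f g : X ⟶ one Y}
    (h : Hom.base f = Hom.base g) (hc : ∀ i k, ¬ InBlock (Hom.base f) i k) : f = g :=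
  hom_ext h fun i k hf => (hc i k hf).elim

/-- The morphism over `cut j` with component `c`. -/
def mid {T : WreathDelta A} {Y : A} (j : Fin T.len) (c : T.obj j ⟶ Y) : T ⟶ one Y :=
  show Hom _ _ from
  ⟨cut j, fun _ _ h => eqToHom (congrArg T.obj (inBlock_cut.1 h)) ≫ c⟩

theorem mid_component {T : WreathDelta A} {Y : A} (j : Fin T.len) (c : T.obj j ⟶ Y) (k)
    (h : InBlock (cut j) j k) : Hom.component (mid j c) j k h = c := Category.id_comp _

theorem mid_comp_single {T : WreathDelta A} {Y Z : A} (j : Fin T.len) (c : T.obj j ⟶ Y)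
    (g : Y ⟶ Z) : mid j c ≫ Theta.single g = mid j (c ≫ g) := by
  refine hom_ext (base_comp_single _ _) fun i k hf hg => ?_
  obtain rfl : i = j := inBlock_cut.1 hg
  exact (component_comp_single (mid i c) g i k hf hg).trans
    ((congrArg (· ≫ g) (mid_component _ _ _ _)).trans (mid_component _ _ _ _).symm)

/-- An operator to a one-term tuple which has a component is determined by it. -/
theorem eq_mid {T : WreathDelta A} {Y : A} (f : T ⟶ one Y) {j k}
    (h : InBlock (Hom.base f) j k) : f = mid j (Hom.component f j k h) := by
  refine hom_ext h.eq_cut fun i l hf hg => ?_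
  obtain rfl : i = j := inBlock_cut.1 hg
  obtain rfl : l = k := Subsingleton.elim _ _
  exact (mid_component _ _ _ _).symm

end WreathDelta

namespace DiskShape

variable {A : Type u} [Category.{0} A] (X : DiskShape A)

open WreathDelta

/-- The shape induced on `Δ ≀ A` by a shape in `A`, as in the definition of `Θ`. -/
def wreath : DiskShape (WreathDelta A) where
  lin
    | 0 => ⟨0, Fin.elim0⟩
    | k + 1 => ⟨1, fun _ => X.lin k⟩
  fork
    | 0 => ⟨2, fun _ => X.lin 0⟩
    | k + 1 => ⟨1, fun _ => X.fork k⟩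
  proj
    | 0 => show Hom _ _ from { base := SimplexCategory.σ 0, component := fun _ k => k.elim0 }
    | k + 1 => Theta.single (X.proj k)
  src
    | 0 => show Hom _ _ from { base := SimplexCategory.δ 1, component := fun i => i.elim0 }
    | k + 1 => Theta.single (X.src k)
  tgt
    | 0 => show Hom _ _ from { base := SimplexCategory.δ 0, component := fun i => i.elim0 }
    | k + 1 => Theta.single (X.tgt k)
  deg₀
    | 0 => show Hom _ _ from { base := SimplexCategory.σ 0, component := fun _ _ _ => 𝟙 _ }
    | k + 1 => Theta.single (X.deg₀ k)
  deg₁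
    | 0 => show Hom _ _ from { base := SimplexCategory.σ 1, component := fun _ _ _ => 𝟙 _ }
    | k + 1 => Theta.single (X.deg₁ k)

end DiskShape

/-! ### The nerve of a tuple is a finite disk -/

namespace DiskShape

open WreathDelta

variable {A : Type u} [Category.{0} A] (X : DiskShape A)

theorem not_inBlock_of_const {m : ℕ} {β : SimplexCategory.mk m ⟶ SimplexCategory.mk 1} {c : Fin 2}
    (h : ∀ a, β.toOrderHom a = c) (i : Fin m) (k : Fin 1) : ¬ InBlock β i k := fun hb => by
  rw [inBlock_one, h, h] at hb
  exact absurd (hb.1.symm.trans hb.2) (by decide)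

theorem base_comp_wreath_src_zero {S : WreathDelta A} (y : S ⟶ X.wreath.lin 0)
    (a : Fin (S.len + 1)) : (Hom.base (y ≫ X.wreath.src 0)).toOrderHom a = (0 : Fin 2) := by
  have : ∀ b : Fin 1, (SimplexCategory.δ (1 : Fin 2)).toOrderHom b = (0 : Fin 2) := by decide
  exact this ((Hom.base y).toOrderHom a)

theorem base_comp_wreath_tgt_zero {S : WreathDelta A} (y : S ⟶ X.wreath.lin 0)
    (a : Fin (S.len + 1)) : (Hom.base (y ≫ X.wreath.tgt 0)).toOrderHom a = (1 : Fin 2) := by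
  have : ∀ b : Fin 1, (SimplexCategory.δ (0 : Fin 2)).toOrderHom b = (1 : Fin 2) := by decide
  exact this ((Hom.base y).toOrderHom a)

theorem eq_comp_src_of_const {S : WreathDelta A} {k : ℕ} (x : S ⟶ one (X.lin k))
    (h : ∀ a, (Hom.base x).toOrderHom a = (0 : Fin 2)) :
    x = (show S ⟶ X.wreath.lin (k + 1) from x) ≫ X.wreath.proj k ≫ X.wreath.src k := by
  rw [← Category.assoc]
  refine hom_ext_of_const ?_ (not_inBlock_of_const h)
  cases k with
  | zero =>
    exact SimplexCategory.hom_ext_apply fun a =>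
      (h a).trans (base_comp_wreath_src_zero X _ a).symm
  | succ k => exact ((base_comp_single _ (X.src k)).trans (base_comp_single _ (X.proj k))).symm

theorem eq_comp_tgt_of_const {S : WreathDelta A} {k : ℕ} (x : S ⟶ one (X.lin k))
    (h : ∀ a, (Hom.base x).toOrderHom a = (1 : Fin 2)) :
    x = (show S ⟶ X.wreath.lin (k + 1) from x) ≫ X.wreath.proj k ≫ X.wreath.tgt k := by
  rw [← Category.assoc]
  refine hom_ext_of_const ?_ (not_inBlock_of_const h)
  cases k with
  | zero =>
    exact SimplexCategory.hom_ext_apply fun a =>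
      (h a).trans (base_comp_wreath_tgt_zero X _ a).symm
  | succ k => exact ((base_comp_single _ (X.tgt k)).trans (base_comp_single _ (X.proj k))).symm

/-- In positive dimension, two cells of the nerve of a tuple are comparable iff they lie over the
same operator of `Δ` and have comparable components. -/
theorem wreath_le_succ {n : ℕ} {S : WreathDelta A} {k : ℕ} (hk : k + 1 < n + 1)
    (x y : S ⟶ one (X.lin (k + 1))) :
    (X.wreath.nerve.{w} (n + 1) S).le (k + 1) hk ⟨x⟩ ⟨y⟩ ↔
      Hom.base x = Hom.base y ∧ ∀ i j hx hy, (X.nerve.{w} n (S.obj i)).le k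
        (Nat.lt_of_succ_lt_succ hk) ⟨Hom.component x i j hx⟩ ⟨Hom.component y i j hy⟩ := by
  constructor
  · rintro ⟨⟨z⟩, hx, hy⟩
    obtain rfl : z ≫ Theta.single (X.deg₀ k) = x := congrArg ULift.down hx
    obtain rfl : z ≫ Theta.single (X.deg₁ k) = y := congrArg ULift.down hy
    refine ⟨rfl, fun i j hx hy => ⟨⟨Hom.component z i j ?_⟩, ?_⟩⟩
    · exact (base_comp_single (Y := X.fork k) z (X.deg₀ k)) ▸ hx
    · exact ⟨congrArg ULift.up (component_comp_single _ _ _ _ _ _).symm,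
        congrArg ULift.up (component_comp_single _ _ _ _ _ _).symm⟩
  · rintro ⟨hb, hc⟩
    have hc' := fun i j hx => hc i j hx (hb ▸ hx)
    choose z hz using hc'
    let z' : S ⟶ one (X.fork k) :=
      show Hom _ _ from ⟨Hom.base (Y := one (X.lin (k + 1))) x, fun i j h => (z i j h).down⟩
    exact ⟨⟨z'⟩, congrArg ULift.up ((comp_single_eq_iff (x := z') (f := X.deg₀ k)).2
        ⟨rfl, fun i j _ h => congrArg ULift.down (hz i j h).1⟩),
      congrArg ULift.up ((comp_single_eq_iff (x := z') (f := X.deg₁ k)).2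
        ⟨hb, fun i j h _ => congrArg ULift.down (hz i j h).2⟩)⟩

/-- The cells of dimension one are ordered like the underlying operators `[m] ⟶ [1]`. -/
theorem wreath_le_zero {n : ℕ} {S : WreathDelta A}
    (hX : ∀ i, Nonempty (Unique (S.obj i ⟶ X.lin 0))) (hk : 0 < n + 1)
    (x y : S ⟶ one (X.lin 0)) :
    (X.wreath.nerve.{w} (n + 1) S).le 0 hk ⟨x⟩ ⟨y⟩ ↔
      ∀ a, ((Hom.base x).toOrderHom a : Fin 2) ≤ (Hom.base y).toOrderHom a := by
  have hs : ∀ i, Subsingleton (S.obj i ⟶ X.lin 0) := fun i =>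
    (hX i).elim fun _ => inferInstance
  constructor
  · rintro ⟨⟨z⟩, hx, hy⟩ a
    obtain rfl : z ≫ X.wreath.deg₀ 0 = x := congrArg ULift.down hx
    obtain rfl : z ≫ X.wreath.deg₁ 0 = y := congrArg ULift.down hy
    have : ∀ b : Fin 3, ((SimplexCategory.σ (0 : Fin 2)).toOrderHom b : Fin 2) ≤
      (SimplexCategory.σ (1 : Fin 2)).toOrderHom b := by decide
    exact this ((Hom.base z).toOrderHom a)
  · intro h
    let f : Fin (S.len + 1) → Fin 2 := fun a => (Hom.base x).toOrderHom a
    let g : Fin (S.len + 1) → Fin 2 := fun a => (Hom.base y).toOrderHom a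
    have hf : Monotone f := (Hom.base x).toOrderHom.monotone
    have hg : Monotone g := (Hom.base y).toOrderHom.monotone
    -- The fork cell takes the value `0`, `1` or `2` according to how many of `f`, `g` are `1`.
    let b : SimplexCategory.mk S.len ⟶ SimplexCategory.mk 2 := SimplexCategory.mkHom
      ⟨fun a => ⟨(f a : ℕ) + g a, by have := (f a).isLt; have := (g a).isLt; omega⟩,
        fun a a' h => Nat.add_le_add (hf h) (hg h)⟩
    refine ⟨⟨show Hom _ _ from ⟨b, fun i _ _ => (hX i).some.default⟩⟩, ?_, ?_⟩
    · refine congrArg ULift.up (hom_ext (SimplexCategory.hom_ext_apply fun a => ?_)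
        fun i _ _ _ => (hs i).allEq _ _)
      have key : ∀ (p q : Fin 2) (hpq : p ≤ q) (hb : (p : ℕ) + q < 3),
        (SimplexCategory.σ (0 : Fin 2)).toOrderHom (⟨(p : ℕ) + q, hb⟩ : Fin 3) = p := by decide
      exact key (f a) (g a) (h a) _
    · refine congrArg ULift.up (hom_ext (SimplexCategory.hom_ext_apply fun a => ?_)
        fun i _ _ _ => (hs i).allEq _ _)
      have key : ∀ (p q : Fin 2) (hpq : p ≤ q) (hb : (p : ℕ) + q < 3),
        (SimplexCategory.σ (1 : Fin 2)).toOrderHom (⟨(p : ℕ) + q, hb⟩ : Fin 3) = q := by decide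
      exact key (f a) (g a) (h a) _

end DiskShape

namespace DiskShape

open WreathDelta

variable {A : Type u} [Category.{0} A] (X : DiskShape A)

theorem unique_lin_zero {X : DiskShape A} {n : ℕ} {T : A} (h : (X.nerve.{w} n T).IsDisk) :
    Nonempty (Unique (T ⟶ X.lin 0)) :=
  h.cell_zero.map fun u => @Equiv.unique _ _ u (Equiv.ulift (α := T ⟶ X.lin 0)).symm

theorem monotone_fin_two_total {m : ℕ} {f g : Fin (m + 1) → Fin 2} (hf : Monotone f)
    (hg : Monotone g) : (∀ a, f a ≤ g a) ∨ ∀ a, g a ≤ f a := by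
  by_contra! h
  obtain ⟨⟨a, ha⟩, b, hb⟩ := h
  rcases le_total a b with hab | hab
  · have := hf hab; omega
  · have := hg hab; omega

/-- The wreath construction turns `n`-disks into `(n + 1)`-disks: the nerve of a tuple is the
interval of operators `[m] ⟶ [1]` with the nerves of the terms as fibers over inner points. -/
theorem isDisk_nerve_wreath {n : ℕ} {S : WreathDelta A}
    (H : ∀ i, (X.nerve.{w} n (S.obj i)).IsDisk) : (X.wreath.nerve.{w} (n + 1) S).IsDisk := by
  have hi_s : ∀ k (h : k < n + 1) x, (X.wreath.nerve.{w} (n + 1) S).i k h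
      ((X.wreath.nerve.{w} (n + 1) S).s k h x) = x := by
    rintro k hk ⟨x⟩
    refine congrArg ULift.up ?_
    cases k with
    | zero => exact Subsingleton.elim (α := S ⟶ zero) _ _
    | succ k =>
      refine (comp_single_comp_single _ _ _).trans (comp_single_eq_iff.2 ⟨rfl, fun i j hf _ => ?_⟩)
      rw [← Category.assoc]
      exact congrArg ULift.down ((H i).i_s k (Nat.lt_of_succ_lt_succ hk) ⟨Hom.component x i j hf⟩)
  have hi_t : ∀ k (h : k < n + 1) x, (X.wreath.nerve.{w} (n + 1) S).i k h
      ((X.wreath.nerve.{w} (n + 1) S).t k h x) = x := by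
    rintro k hk ⟨x⟩
    refine congrArg ULift.up ?_
    cases k with
    | zero => exact Subsingleton.elim (α := S ⟶ zero) _ _
    | succ k =>
      refine (comp_single_comp_single _ _ _).trans (comp_single_eq_iff.2 ⟨rfl, fun i j hf _ => ?_⟩)
      rw [← Category.assoc]
      exact congrArg ULift.down ((H i).i_t k (Nat.lt_of_succ_lt_succ hk) ⟨Hom.component x i j hf⟩)
  have ht_t : ∀ k (h : k + 1 < n + 1) x,
      (X.wreath.nerve.{w} (n + 1) S).t (k + 1) h ((X.wreath.nerve.{w} (n + 1) S).t k
        (Nat.lt_of_succ_lt h) x) = (X.wreath.nerve.{w} (n + 1) S).s (k + 1) h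
          ((X.wreath.nerve.{w} (n + 1) S).t k (Nat.lt_of_succ_lt h) x) := by
    rintro k hk ⟨x⟩
    refine congrArg ULift.up ?_
    cases k with
    | zero =>
      refine comp_single_eq_comp_single_iff.2 ⟨rfl, fun i j hf => ?_⟩
      exact (not_inBlock_of_const (base_comp_wreath_tgt_zero X x) i j hf).elim
    | succ k =>
      refine ((comp_single_comp_single _ _ _).trans
        (comp_single_eq_comp_single_iff.2 ⟨rfl, fun i j hf _ => ?_⟩)).trans
          (comp_single_comp_single _ _ _).symm
      rw [← Category.assoc, ← Category.assoc]
      exact congrArg ULift.down ((H i).t_t k (Nat.lt_of_succ_lt_succ hk) ⟨Hom.component x i j hf⟩)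
  have ht_s : ∀ k (h : k + 1 < n + 1) x,
      (X.wreath.nerve.{w} (n + 1) S).t (k + 1) h ((X.wreath.nerve.{w} (n + 1) S).s k
        (Nat.lt_of_succ_lt h) x) = (X.wreath.nerve.{w} (n + 1) S).s (k + 1) h
          ((X.wreath.nerve.{w} (n + 1) S).s k (Nat.lt_of_succ_lt h) x) := by
    rintro k hk ⟨x⟩
    refine congrArg ULift.up ?_
    cases k with
    | zero =>
      refine comp_single_eq_comp_single_iff.2 ⟨rfl, fun i j hf => ?_⟩
      exact (not_inBlock_of_const (base_comp_wreath_src_zero X x) i j hf).elim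
    | succ k =>
      refine ((comp_single_comp_single _ _ _).trans
        (comp_single_eq_comp_single_iff.2 ⟨rfl, fun i j hf _ => ?_⟩)).trans
          (comp_single_comp_single _ _ _).symm
      rw [← Category.assoc, ← Category.assoc]
      exact congrArg ULift.down ((H i).t_s k (Nat.lt_of_succ_lt_succ hk) ⟨Hom.component x i j hf⟩)
  have hu := fun i => unique_lin_zero (H i)
  refine
  { cell_zero := ?_
    i_s := hi_s
    i_t := hi_t
    t_t := ht_t
    t_s := ht_s
    le_fiber := ?_
    le_refl := ?_
    le_trans := ?_
    le_antisymm := ?_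
    le_total := ?_
    s_le := ?_
    le_t := ?_
    equalizer_zero := ?_
    equalizer_succ := ?_ }
  · obtain ⟨z⟩ : Nonempty (S ⟶ (zero : WreathDelta A)) := inferInstance
    exact ⟨{ default := ⟨z⟩,
             uniq := fun x => congrArg ULift.up (Subsingleton.elim (α := S ⟶ zero) x.down z) }⟩
  · rintro k hk ⟨x⟩ ⟨y⟩ h
    refine congrArg ULift.up ?_
    cases k with
    | zero => exact Subsingleton.elim (α := S ⟶ zero) _ _
    | succ k =>
      replace h := (wreath_le_succ X hk x y).1 h
      exact comp_single_eq_comp_single_iff.2 ⟨h.1, fun i j hx hy =>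
        congrArg ULift.down ((H i).le_fiber k (Nat.lt_of_succ_lt_succ hk) _ _ (h.2 i j hx hy))⟩
  · rintro k hk ⟨x⟩
    cases k with
    | zero => exact (wreath_le_zero X hu _ _ _).2 fun a => le_rfl
    | succ k => exact (wreath_le_succ X _ _ _).2 ⟨rfl, fun i j _ _ => (H i).le_refl _ _ _⟩
  · rintro k hk ⟨x⟩ ⟨y⟩ ⟨z⟩ h h'
    cases k with
    | zero =>
      replace h := (wreath_le_zero X hu hk x y).1 h
      replace h' := (wreath_le_zero X hu hk y z).1 h'
      exact (wreath_le_zero X hu hk x z).2 fun a => (h a).trans (h' a)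
    | succ k =>
      replace h := (wreath_le_succ X hk x y).1 h
      replace h' := (wreath_le_succ X hk y z).1 h'
      refine (wreath_le_succ X hk x z).2 ⟨h.1.trans h'.1, fun i j hx hz =>
        (H i).le_trans _ _ _ _ _ (h.2 i j hx (h.1 ▸ hx)) (h'.2 i j _ hz)⟩
  · rintro k hk ⟨x⟩ ⟨y⟩ h h'
    refine congrArg ULift.up ?_
    cases k with
    | zero =>
      replace h := (wreath_le_zero X hu hk x y).1 h
      replace h' := (wreath_le_zero X hu hk y x).1 h'
      exact hom_ext (SimplexCategory.hom_ext_apply fun a => le_antisymm (h a) (h' a))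
        fun i _ _ _ => (hu i).elim fun _ => Subsingleton.elim (α := S.obj i ⟶ X.lin 0) _ _
    | succ k =>
      replace h := (wreath_le_succ X hk x y).1 h
      replace h' := (wreath_le_succ X hk y x).1 h'
      exact hom_ext h.1 fun i j hx hy =>
        congrArg ULift.down ((H i).le_antisymm k _ _ _ (h.2 i j hx hy) (h'.2 i j hy hx))
  · rintro k hk ⟨x⟩ ⟨y⟩ h
    cases k with
    | zero =>
      refine Or.imp (wreath_le_zero X hu hk x y).2 (wreath_le_zero X hu hk y x).2 ?_
      exact monotone_fin_two_total (Hom.base x).toOrderHom.monotone (Hom.base y).toOrderHom.monotone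
    | succ k =>
      obtain ⟨hb, hc⟩ := comp_single_eq_comp_single_iff.1 (congrArg ULift.down h)
      refine Or.imp (wreath_le_succ X hk x y).2 (wreath_le_succ X hk y x).2 ?_
      by_cases hj : ∃ i j, InBlock (Hom.base x) i j
      · obtain ⟨i, j, hx⟩ := hj
        have hy : InBlock (Hom.base y) i j := hb ▸ hx
        have := (H i).le_total k (Nat.lt_of_succ_lt_succ hk) ⟨Hom.component x i j hx⟩
          ⟨Hom.component y i j hy⟩ (congrArg ULift.up (hc i j hx hy))
        refine this.imp (fun h => ⟨hb, fun i' j' hx' hy' => ?_⟩)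
          (fun h => ⟨hb.symm, fun i' j' hy' hx' => ?_⟩)
        all_goals
          obtain rfl : j' = j := Subsingleton.elim (α := Fin 1) _ _
          obtain rfl : i' = i := hx'.unique hx
          exact h
      · push Not at hj
        exact Or.inl ⟨hb, fun i j hx => (hj i j hx).elim⟩
  · rintro k hk x ⟨y⟩ rfl
    cases k with
    | zero =>
      refine (wreath_le_zero X hu _ _ _).2 fun a => ?_
      exact (base_comp_wreath_src_zero X _ a).le.trans (Fin.zero_le _)
    | succ k =>
      refine (congrArg (fun z => (X.wreath.nerve (n + 1) S).le (k + 1) hk ⟨z⟩ ⟨y⟩)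
        (comp_single_comp_single y (X.proj k) (X.src k))).mpr ((wreath_le_succ X hk _ y).2
          ⟨base_comp_single _ _, fun i j hx hy => ?_⟩)
      refine (congrArg (fun z => (X.nerve n (S.obj i)).le k _ ⟨z⟩ ⟨Hom.component y i j hy⟩)
        ((component_comp_single y _ i j hx hy).trans (Category.assoc _ _ _).symm)).mpr ?_
      exact (H i).s_le k (Nat.lt_of_succ_lt_succ hk) _ ⟨Hom.component y i j hy⟩ rfl
  · rintro k hk x ⟨y⟩ rfl
    cases k with
    | zero =>
      refine (wreath_le_zero X hu _ _ _).2 fun a => ?_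
      exact (Fin.le_last _).trans (base_comp_wreath_tgt_zero X _ a).ge
    | succ k =>
      refine (congrArg (fun z => (X.wreath.nerve (n + 1) S).le (k + 1) hk ⟨y⟩ ⟨z⟩)
        (comp_single_comp_single y (X.proj k) (X.tgt k))).mpr ((wreath_le_succ X hk y _).2
          ⟨(base_comp_single _ _).symm, fun i j hy hx => ?_⟩)
      refine (congrArg (fun z => (X.nerve n (S.obj i)).le k _ ⟨Hom.component y i j hy⟩ ⟨z⟩)
        ((component_comp_single y _ i j hx hy).trans (Category.assoc _ _ _).symm)).mpr ?_
      exact (H i).le_t k (Nat.lt_of_succ_lt_succ hk) _ ⟨Hom.component y i j hy⟩ rfl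
  · intro hk
    refine Set.eq_empty_of_forall_notMem fun ⟨x⟩ hx => ?_
    have h1 := base_comp_wreath_src_zero X x 0
    rw [show x ≫ X.wreath.src 0 = x ≫ X.wreath.tgt 0 from congrArg ULift.down hx] at h1
    exact Fin.zero_ne_one (n := 0) (h1.symm.trans (base_comp_wreath_tgt_zero X x 0))
  · intro k hk
    refine Set.Subset.antisymm ?_ ?_
    · rintro ⟨x⟩ hx
      obtain ⟨-, hc⟩ := comp_single_eq_comp_single_iff.1 (congrArg ULift.down hx)
      rcases exists_inBlock_or_const (Hom.base x) with ⟨i, hi⟩ | h | h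
      · cases k with
        | zero =>
          have := (H i).equalizer_zero (Nat.lt_of_succ_lt_succ hk)
          exact absurd (this.subset (congrArg ULift.up (hc i 0 hi hi))) (Set.notMem_empty _)
        | succ k =>
          have := (H i).equalizer_succ k (Nat.lt_of_succ_lt_succ hk)
          rcases this.subset (congrArg ULift.up (hc i 0 hi hi)) with ⟨y, hy⟩ | ⟨y, hy⟩
          · refine Or.inl ⟨⟨mid i y.down⟩, congrArg ULift.up ?_⟩
            rw [eq_mid x hi]
            exact (mid_comp_single _ _ _).trans (congrArg (mid i) (congrArg ULift.down hy))
          · refine Or.inr ⟨⟨mid i y.down⟩, congrArg ULift.up ?_⟩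
            rw [eq_mid x hi]
            exact (mid_comp_single _ _ _).trans (congrArg (mid i) (congrArg ULift.down hy))
      · refine Or.inl ⟨⟨(show S ⟶ X.wreath.lin (k + 1) from x) ≫ X.wreath.proj k⟩, ?_⟩
        exact congrArg ULift.up ((Category.assoc _ _ _).trans (eq_comp_src_of_const X x h).symm)
      · refine Or.inr ⟨⟨(show S ⟶ X.wreath.lin (k + 1) from x) ≫ X.wreath.proj k⟩, ?_⟩
        exact congrArg ULift.up ((Category.assoc _ _ _).trans (eq_comp_tgt_of_const X x h).symm)
    · rintro _ (⟨x, rfl⟩ | ⟨x, rfl⟩)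
      · exact (ht_s k hk x).symm
      · exact (ht_t k hk x).symm

/-- There are finitely many operators to a one-term tuple, as they are determined by the
underlying operator of `Δ` and its components. -/
theorem isFiniteDisk_nerve_wreath {n : ℕ} {S : WreathDelta A}
    (H : ∀ i, (X.nerve.{w} n (S.obj i)).IsFiniteDisk) :
    (X.wreath.nerve.{w} (n + 1) S).IsFiniteDisk where
  __ := X.isDisk_nerve_wreath fun i => (H i).toIsDisk
  finite k hk := by
    suffices Finite (S ⟶ X.wreath.lin k) from @Finite.of_equiv _ _ this Equiv.ulift.symm
    cases k with
    | zero => exact inferInstanceAs (Finite (S ⟶ (zero : WreathDelta A)))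
    | succ k =>
      have : ∀ i, Finite (S.obj i ⟶ X.lin k) := fun i =>
        @Finite.of_equiv _ _ ((H i).finite k (Nat.le_of_succ_le_succ hk)) Equiv.ulift
      have hf : Finite (SimplexCategory.mk S.len ⟶ SimplexCategory.mk 1) :=
        Finite.of_injective (fun f => (f.toOrderHom : Fin (S.len + 1) → Fin 2))
          fun f g h => SimplexCategory.hom_ext_apply (congrFun h)
      let e : (S ⟶ one (X.lin k)) →
          Σ β : SimplexCategory.mk S.len ⟶ SimplexCategory.mk 1,
            ∀ i (j : Fin 1), InBlock β i j → (S.obj i ⟶ X.lin k) :=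
        fun f => ⟨Hom.base f, Hom.component f⟩
      refine Finite.of_injective e fun f g h => ?_
      obtain ⟨b, c⟩ := f
      obtain ⟨b', c'⟩ := g
      cases h
      rfl

end DiskShape

/-! ### The nerve is fully faithful on tuples -/

namespace DiskShape

open WreathDelta

variable {A : Type u} [Category.{0} A] (X : DiskShape A)

/-- A map to `[m]` is determined by its composites with the maps `cut j`. -/
theorem eq_of_comp_cut {m p : ℕ} {f g : SimplexCategory.mk p ⟶ SimplexCategory.mk m}
    (h : ∀ j, f ≫ cut j = g ≫ cut j) : f = g := by
  refine SimplexCategory.hom_ext_apply fun a => ?_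
  have key : ∀ j : Fin m, j.castSucc < f.toOrderHom a ↔ j.castSucc < g.toOrderHom a := fun j => by
    have := congrArg (fun q : SimplexCategory.mk p ⟶ SimplexCategory.mk 1 => q.toOrderHom a) (h j)
    simp only [comp_cut_apply] at this
    split_ifs at this with h1 h2 h2
    · exact iff_of_true h1 h2
    · exact absurd this.symm Fin.zero_ne_one
    · exact absurd this Fin.zero_ne_one
    · exact iff_of_false h1 h2
  have hle : ∀ x y : Fin (m + 1), (∀ j : Fin m, j.castSucc < x → j.castSucc < y) → x ≤ y := by
    intro x y hxy
    by_contra! hlt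
    exact lt_irrefl _ (hxy ⟨y, by omega⟩ hlt)
  exact le_antisymm (hle _ _ fun j => (key j).1) (hle _ _ fun j => (key j).2)

/-- The underlying operator is detected by the cells of dimension one, a component into the `j`-th
term by the cells over `cut j`. -/
theorem wreath_faithful {n : ℕ} (H : X.IsDuality.{w} n) {S T : WreathDelta A} (f g : S ⟶ T)
    (h : ∀ k, k ≤ n + 1 → ∀ x : T ⟶ X.wreath.lin k, f ≫ x = g ≫ x) : f = g := by
  have hb : Hom.base f = Hom.base g := eq_of_comp_cut fun j => by
    obtain ⟨u⟩ := unique_lin_zero (H.isFiniteDisk (T.obj j)).toIsDisk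
    exact congrArg Hom.base (h 1 (Nat.le_add_left _ _) (mid j u.default))
  refine hom_ext hb fun i j hf hg => H.faithful _ _ fun k hk x => ?_
  have e := h (k + 1) (Nat.succ_le_succ hk) (mid j x)
  have hc : InBlock (Hom.base (f ≫ mid j x)) i 0 := InBlock.cut_iff.2 hf
  have hc' : InBlock (Hom.base (g ≫ mid j x)) i 0 := InBlock.cut_iff.2 hg
  have e1 := comp_component f (mid j x) hc hf (inBlock_cut.2 rfl)
  have e2 := comp_component g (mid j x) hc' hg (inBlock_cut.2 rfl)
  rw [mid_component] at e1 e2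
  rw [← e1, ← e2]
  exact component_congr e _ _

section Full

variable {X} {n : ℕ} {S T : WreathDelta A}
  (φ : X.wreath.nerve.{w} (n + 1) T ⟶ X.wreath.nerve.{w} (n + 1) S)

/-- The action of a map of nerves on a cell of positive dimension. -/
def act (k : ℕ) (hk : k ≤ n) (x : T ⟶ one (X.lin k)) : S ⟶ one (X.lin k) :=
  (DiskData.Hom.app φ (k + 1) (Nat.succ_le_succ hk) ⟨x⟩).down

theorem act_proj {k : ℕ} (hk : k < n) (x : T ⟶ one (X.lin (k + 1))) :
    act φ k hk.le (x ≫ Theta.single (X.proj k)) = act φ (k + 1) hk x ≫ Theta.single (X.proj k) :=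
  congrArg ULift.down (DiskData.Hom.app_i φ (k + 1) (Nat.succ_lt_succ hk) ⟨x⟩)

theorem act_src {k : ℕ} (hk : k < n) (x : T ⟶ one (X.lin k)) :
    act φ (k + 1) hk (x ≫ Theta.single (X.src k)) = act φ k hk.le x ≫ Theta.single (X.src k) :=
  congrArg ULift.down (DiskData.Hom.app_s φ (k + 1) (Nat.succ_lt_succ hk) ⟨x⟩)

theorem act_tgt {k : ℕ} (hk : k < n) (x : T ⟶ one (X.lin k)) :
    act φ (k + 1) hk (x ≫ Theta.single (X.tgt k)) = act φ k hk.le x ≫ Theta.single (X.tgt k) :=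
  congrArg ULift.down (DiskData.Hom.app_t φ (k + 1) (Nat.succ_lt_succ hk) ⟨x⟩)

/-- The operator under the action on a cell over `cut j` depends on `j` only. -/
theorem base_act_mid (H : X.IsDuality.{w} n) {j : Fin T.len} {k l : ℕ} (hk : k ≤ n) (hl : l ≤ n)
    (c : T.obj j ⟶ X.lin k) (d : T.obj j ⟶ X.lin l) :
    Hom.base (act φ k hk (mid j c)) = Hom.base (act φ l hl (mid j d)) := by
  obtain ⟨u⟩ := unique_lin_zero (H.isFiniteDisk (T.obj j)).toIsDisk
  have key : ∀ (k : ℕ) (hk : k ≤ n) (c : T.obj j ⟶ X.lin k),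
      Hom.base (act φ k hk (mid j c)) = Hom.base (act φ 0 n.zero_le (mid j u.default)) := by
    intro k
    induction k with
    | zero =>
      intro hk c
      rw [u.uniq c]
    | succ k ih =>
      intro hk c
      rw [← ih (Nat.le_of_succ_le hk) (c ≫ X.proj k), ← mid_comp_single, act_proj φ hk]
      exact (base_comp_single _ (X.proj k)).symm
  rw [key k hk c, key l hl d]

/-- Cells over a constant operator are iterated images of `src` or `tgt`, hence so are their images
under a map of nerves. -/
theorem act_of_const_zero {k : ℕ} (hk : k ≤ n) (x : T ⟶ one (X.lin k))
    (h : ∀ a, (Hom.base x).toOrderHom a = (0 : Fin 2)) (a : Fin (S.len + 1)) :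
    (Hom.base (act φ k hk x)).toOrderHom a = (0 : Fin 2) := by
  induction k with
  | zero =>
    have e : act φ 0 hk x = _ := (congrArg (act φ 0 hk) ((eq_comp_src_of_const X x h).trans
      (Category.assoc _ _ _).symm)).trans (congrArg ULift.down
        (DiskData.Hom.app_s φ 0 n.succ_pos ⟨(x : T ⟶ X.wreath.lin 1) ≫ X.wreath.proj 0⟩))
    rw [e]
    exact base_comp_wreath_src_zero X _ a
  | succ k ih =>
    have e := (congrArg (act φ (k + 1) hk) ((eq_comp_src_of_const X x h).trans
      (Category.assoc _ _ _).symm)).trans (act_src φ hk (x ≫ Theta.single (X.proj k)))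
    rw [e]
    refine (congrArg (fun q : SimplexCategory.mk S.len ⟶ SimplexCategory.mk 1 => q.toOrderHom a)
      (base_comp_single _ _)).trans (ih _ _ fun b => ?_)
    exact (congrArg (fun q : SimplexCategory.mk T.len ⟶ SimplexCategory.mk 1 => q.toOrderHom b)
      (base_comp_single _ _)).trans (h b)

theorem act_of_const_one {k : ℕ} (hk : k ≤ n) (x : T ⟶ one (X.lin k))
    (h : ∀ a, (Hom.base x).toOrderHom a = (1 : Fin 2)) (a : Fin (S.len + 1)) :
    (Hom.base (act φ k hk x)).toOrderHom a = (1 : Fin 2) := by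
  induction k with
  | zero =>
    have e : act φ 0 hk x = _ := (congrArg (act φ 0 hk) ((eq_comp_tgt_of_const X x h).trans
      (Category.assoc _ _ _).symm)).trans (congrArg ULift.down
        (DiskData.Hom.app_t φ 0 n.succ_pos ⟨(x : T ⟶ X.wreath.lin 1) ≫ X.wreath.proj 0⟩))
    rw [e]
    exact base_comp_wreath_tgt_zero X _ a
  | succ k ih =>
    have e := (congrArg (act φ (k + 1) hk) ((eq_comp_tgt_of_const X x h).trans
      (Category.assoc _ _ _).symm)).trans (act_tgt φ hk (x ≫ Theta.single (X.proj k)))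
    rw [e]
    refine (congrArg (fun q : SimplexCategory.mk S.len ⟶ SimplexCategory.mk 1 => q.toOrderHom a)
      (base_comp_single _ _)).trans (ih _ _ fun b => ?_)
    exact (congrArg (fun q : SimplexCategory.mk T.len ⟶ SimplexCategory.mk 1 => q.toOrderHom b)
      (base_comp_single _ _)).trans (h b)

/-- A family of maps `[p] ⟶ [1]` indexed by `Fin m` and decreasing in the index comes from
a map `[p] ⟶ [m]` by composition with the maps `cut j`. -/
theorem exists_comp_cut {m p : ℕ} (χ : Fin m → (SimplexCategory.mk p ⟶ SimplexCategory.mk 1))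
    (h : ∀ i j, i ≤ j → ∀ a, ((χ j).toOrderHom a : Fin 2) ≤ (χ i).toOrderHom a) :
    ∃ β : SimplexCategory.mk p ⟶ SimplexCategory.mk m, ∀ j, β ≫ cut j = χ j := by
  let s : Fin (p + 1) → Finset (Fin m) := fun a =>
    Finset.univ.filter fun j => ((χ j).toOrderHom a : Fin 2) = 1
  have hs : ∀ a b, a ≤ b → s a ⊆ s b := fun a b hab j hj => by
    simp only [s, Finset.mem_filter, Finset.mem_univ, true_and] at hj ⊢
    have : ((χ j).toOrderHom a : Fin 2) ≤ (χ j).toOrderHom b := (χ j).toOrderHom.monotone hab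
    rw [hj] at this
    exact le_antisymm (Fin.le_last _) this
  -- `s a` is an initial segment, so that it is determined by its cardinality.
  have hmem : ∀ a (j : Fin m), (j : ℕ) < (s a).card ↔ j ∈ s a := by
    intro a j
    have hlow : ∀ i j, i ≤ j → j ∈ s a → i ∈ s a := fun i j hij hj => by
      simp only [s, Finset.mem_filter, Finset.mem_univ, true_and] at hj ⊢
      have := h i j hij a
      rw [hj] at this
      exact le_antisymm (Fin.le_last _) this
    constructor
    · intro hj
      by_contra hn
      have : s a ⊆ Finset.Iio j := fun i hi => Finset.mem_Iio.2 (by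
        by_contra hle
        exact hn (hlow j i (not_lt.1 hle) hi))
      have := Finset.card_le_card this
      rw [Fin.card_Iio] at this
      omega
    · intro hj
      have : Finset.Iic j ⊆ s a := fun i hi => hlow i j (Finset.mem_Iic.1 hi) hj
      have := Finset.card_le_card this
      rw [Fin.card_Iic] at this
      omega
  refine ⟨SimplexCategory.mkHom ⟨fun a => ⟨(s a).card, ?_⟩, fun a b hab =>
    Finset.card_le_card (hs a b hab)⟩, fun j => SimplexCategory.hom_ext_apply fun a => ?_⟩
  · exact Nat.lt_succ_of_le ((Finset.card_le_univ _).trans_eq (Fintype.card_fin m))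
  · rw [comp_cut_apply]
    have : (j.castSucc < (⟨(s a).card, Nat.lt_succ_of_le ((Finset.card_le_univ _).trans_eq
        (Fintype.card_fin m))⟩ : Fin (m + 1))) ↔ ((χ j).toOrderHom a : Fin 2) = 1 :=
      (hmem a j).trans (by simp [s])
    refine (if_congr this rfl rfl).trans ?_
    split_ifs with hj
    · exact hj.symm
    · by_contra hne
      exact hj (Fin.eq_one_of_ne_zero _ (Ne.symm hne))

/-- A map of nerves acts on cells of dimension one by a map of intervals, which is dual to an operator
of `Δ`, and it restricts to maps between the nerves of the terms, which are induced by operators of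
`A`. -/
theorem wreath_full (H : X.IsDuality.{w} n) : ∃ f : S ⟶ T, X.wreath.nerveMap (n + 1) f = φ := by
  have hu : ∀ {R : WreathDelta A} (j : Fin R.len), Nonempty (Unique (R.obj j ⟶ X.lin 0)) :=
    fun {R} j => unique_lin_zero (H.isFiniteDisk (R.obj j)).toIsDisk
  let v : ∀ j : Fin T.len, T ⟶ one (X.lin 0) := fun j => mid j (hu j).some.default
  obtain ⟨β, hβ⟩ := exists_comp_cut (fun j => Hom.base (act φ 0 n.zero_le (v j)))
    (fun i j hij a => by
      refine (wreath_le_zero X hu n.succ_pos _ _).1 (DiskData.Hom.app_le φ 0 n.succ_pos ⟨v j⟩ ⟨v i⟩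
        ((wreath_le_zero X hu _ _ _).2 fun b => ?_)) a
      refine le_of_eq_of_le (cut_apply j b) (le_of_le_of_eq ?_ (cut_apply i b).symm)
      split_ifs with h1 h2
      · exact le_rfl
      · exact absurd ((Fin.castSucc_le_castSucc_iff.2 hij).trans_lt h1) h2
      · exact Fin.zero_le _
      · exact le_rfl)
  have hb : ∀ (k : ℕ) (hk : k ≤ n) (j : Fin T.len) (c : T.obj j ⟶ X.lin k),
      Hom.base (act φ k hk (mid j c)) = β ≫ cut j := fun k hk j c =>
    (base_act_mid φ H hk n.zero_le c _).trans (hβ j).symm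
  have hb' : ∀ (k : ℕ) (hk : k ≤ n) (i : Fin S.len) (j : Fin T.len) (c : T.obj j ⟶ X.lin k),
      InBlock β i j → InBlock (Hom.base (act φ k hk (mid j c))) i 0 := fun k hk i j c h => by
    rw [hb]
    exact InBlock.cut_iff.2 h
  have hf : ∀ (i : Fin S.len) (j : Fin T.len) (h : InBlock β i j), ∃ f : S.obj i ⟶ T.obj j,
      ∀ (k : ℕ) (hk : k ≤ n) (c : T.obj j ⟶ X.lin k),
        f ≫ c = Hom.component (act φ k hk (mid j c)) i 0 (hb' k hk i j c h) := by
    intro i j h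
    let ψ : X.nerve.{w} n (T.obj j) ⟶ X.nerve.{w} n (S.obj i) := show DiskData.Hom _ _ from
      { app := fun k hk c => ⟨Hom.component (act φ k hk (mid j c.down)) i 0 (hb' k hk i j _ h)⟩
        app_i := fun k hk c => congrArg ULift.up ((component_congr
          ((congrArg (act φ k hk.le) (mid_comp_single j c.down (X.proj k)).symm).trans
            (act_proj φ hk (mid j c.down))) _
              ((base_comp_single _ (X.proj k)).symm ▸ hb' _ hk i j _ h)).trans
              (component_comp_single _ (X.proj k) i 0 _ (hb' _ hk i j _ h)))
        app_s := fun k hk c => congrArg ULift.up ((component_congr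
          ((congrArg (act φ (k + 1) hk) (mid_comp_single j c.down (X.src k)).symm).trans
            (act_src φ hk (mid j c.down))) _
              ((base_comp_single _ (X.src k)).symm ▸ hb' _ hk.le i j _ h)).trans
              (component_comp_single _ (X.src k) i 0 _ (hb' _ hk.le i j _ h)))
        app_t := fun k hk c => congrArg ULift.up ((component_congr
          ((congrArg (act φ (k + 1) hk) (mid_comp_single j c.down (X.tgt k)).symm).trans
            (act_tgt φ hk (mid j c.down))) _
              ((base_comp_single _ (X.tgt k)).symm ▸ hb' _ hk.le i j _ h)).trans
              (component_comp_single _ (X.tgt k) i 0 _ (hb' _ hk.le i j _ h)))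
        app_le := fun k hk c d hcd => by
          refine ((wreath_le_succ X (Nat.succ_lt_succ hk) _ _).1 (DiskData.Hom.app_le φ (k + 1)
            (Nat.succ_lt_succ hk) ⟨mid j c.down⟩ ⟨mid j d.down⟩
              ((wreath_le_succ X _ _ _).2 ⟨rfl, fun i l hx hy => ?_⟩))).2 i 0 _ _
          obtain rfl : i = j := inBlock_cut.1 hx
          exact (congrArg₂ (fun p q => (X.nerve.{w} n (T.obj i)).le k hk ⟨p⟩ ⟨q⟩)
            (mid_component i c.down l hx) (mid_component i d.down l hy)).mpr hcd }
    obtain ⟨f, hf⟩ := H.full ψ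
    refine ⟨f, fun k hk c => ?_⟩
    exact congrArg (fun q : X.nerve.{w} n (T.obj j) ⟶ X.nerve.{w} n (S.obj i) =>
      (DiskData.Hom.app q k hk ⟨c⟩).down) hf
  choose f hf using hf
  let F : S ⟶ T := show Hom _ _ from ⟨β, f⟩
  refine ⟨F, DiskData.Hom.ext (funext fun k => funext fun hk => funext fun ⟨x⟩ =>
    congrArg ULift.up ?_)⟩
  cases k with
  | zero => exact Subsingleton.elim (α := S ⟶ zero) _ _
  | succ k =>
    change T ⟶ one (X.lin k) at x
    change F ≫ x = act φ k (Nat.le_of_succ_le_succ hk) x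
    rcases exists_inBlock_or_const (Hom.base x) with ⟨j, hj⟩ | h | h
    · obtain ⟨c, rfl⟩ : ∃ c, x = mid j c := ⟨_, eq_mid x hj⟩
      refine hom_ext (hb _ _ j c).symm fun i l hi hi' => ?_
      obtain rfl : l = 0 := Subsingleton.elim (α := Fin 1) _ _
      have hij : InBlock β i j := InBlock.cut_iff.1 hi
      rw [comp_component F (mid j c) hi hij (inBlock_cut.2 rfl), mid_component]
      exact hf i j hij k _ c
    · refine hom_ext_of_const (SimplexCategory.hom_ext_apply fun a => ?_)
        (not_inBlock_of_const fun a => h (β.toOrderHom a))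
      exact (h (β.toOrderHom a)).trans (act_of_const_zero φ _ x h a).symm
    · refine hom_ext_of_const (SimplexCategory.hom_ext_apply fun a => ?_)
        (not_inBlock_of_const fun a => h (β.toOrderHom a))
      exact (h (β.toOrderHom a)).trans (act_of_const_one φ _ x h a).symm

end Full

end DiskShape

/-! ### Maps of disks, and the fibers over the cells of dimension one -/

namespace DiskData

theorem comp_app {n : ℕ} {D E F : DiskData.{w} n} (f : D ⟶ E) (g : E ⟶ F) (k : ℕ) (h : k ≤ n)
    (x : D.cell k h) : Hom.app (f ≫ g) k h x = Hom.app g k h (Hom.app f k h x) := rfl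

theorem id_app {n : ℕ} (D : DiskData.{w} n) (k : ℕ) (h : k ≤ n) (x : D.cell k h) :
    Hom.app (𝟙 D) k h x = x := rfl

theorem hom_ext {n : ℕ} {D E : DiskData.{w} n} {f g : D ⟶ E}
    (h : ∀ k (hk : k ≤ n) x, Hom.app f k hk x = Hom.app g k hk x) : f = g :=
  Hom.ext (funext fun k => funext fun hk => funext (h k hk))

theorem hom_inv_app {n : ℕ} {D E : DiskData.{w} n} (e : D ≅ E) (k : ℕ) (h : k ≤ n)
    (x : D.cell k h) : Hom.app e.inv k h (Hom.app e.hom k h x) = x := by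
  rw [← comp_app, e.hom_inv_id, id_app]

theorem inv_hom_app {n : ℕ} {D E : DiskData.{w} n} (e : D ≅ E) (k : ℕ) (h : k ≤ n)
    (x : E.cell k h) : Hom.app e.hom k h (Hom.app e.inv k h x) = x := by
  rw [← comp_app, e.inv_hom_id, id_app]

/-- Since the fibers are linearly ordered, an injective map of disks reflects the order. -/
theorem le_of_app_le {n : ℕ} {D E : DiskData.{w} n} (hD : D.IsDisk) (hE : E.IsDisk) (f : D ⟶ E)
    (hf : ∀ k (h : k ≤ n), Function.Injective (Hom.app f k h)) (k : ℕ) (h : k < n)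
    (x y : D.cell (k + 1) h) (hxy : E.le k h (Hom.app f _ h x) (Hom.app f _ h y)) :
    D.le k h x y := by
  have hi : D.i k h x = D.i k h y := hf _ _ (by
    rw [Hom.app_i, Hom.app_i, hE.le_fiber _ _ _ _ hxy])
  rcases hD.le_total k h x y hi with h' | h'
  · exact h'
  · obtain rfl := hf _ _ (hE.le_antisymm _ _ _ _ hxy (Hom.app_le f _ _ _ _ h'))
    exact h'

/-- A levelwise bijective map reflecting the order is an isomorphism. -/
theorem isIso_of_bijective {n : ℕ} {D E : DiskData.{w} n} (f : D ⟶ E)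
    (hf : ∀ k (h : k ≤ n), Function.Bijective (Hom.app f k h))
    (hle : ∀ k (h : k < n) x y, E.le k h (Hom.app f _ h x) (Hom.app f _ h y) → D.le k h x y) :
    IsIso f := by
  let e := fun k h => Equiv.ofBijective _ (hf k h)
  have he : ∀ k h x, Hom.app f k h ((e k h).symm x) = x := fun k h x => (e k h).apply_symm_apply x
  let g : E ⟶ D := show Hom _ _ from
    { app := fun k h => (e k h).symm
      app_i := fun k h x => (hf _ _).1 (by rw [he, Hom.app_i, he])
      app_s := fun k h x => (hf _ _).1 (by rw [he, Hom.app_s, he])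
      app_t := fun k h x => (hf _ _).1 (by rw [he, Hom.app_t, he])
      app_le := fun k h x y hxy => hle _ _ _ _ (by rwa [he, he]) }
  exact ⟨g, hom_ext fun k h x => (e k h).symm_apply_apply x, hom_ext fun k h x => he k h x⟩

/-- The cell of dimension one under a cell of positive dimension. -/
def base {n : ℕ} (D : DiskData.{w} (n + 1)) : ∀ (k : ℕ) (h : k ≤ n),
    D.cell (k + 1) (Nat.succ_le_succ h) → D.cell 1 (Nat.le_add_left 1 n)
  | 0, _, x => x
  | k + 1, h, x => base D k (Nat.le_of_succ_le h) (D.i (k + 1) (Nat.succ_le_succ h) x)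

/-- The part of a disk lying over a cell of dimension one, shifted down by one dimension. -/
def fiber {n : ℕ} (D : DiskData.{w} (n + 1)) (hD : D.IsDisk) (d : D.cell 1 (Nat.le_add_left 1 n)) :
    DiskData.{w} n where
  cell k h := {x : D.cell (k + 1) (Nat.succ_le_succ h) // D.base k h x = d}
  i k h x := ⟨D.i (k + 1) (Nat.succ_le_succ h) x.1, x.2⟩
  s k h x := ⟨D.s (k + 1) (Nat.succ_le_succ h) x.1,
    (congrArg (D.base k h.le) (hD.i_s _ (Nat.succ_le_succ h) x.1)).trans x.2⟩
  t k h x := ⟨D.t (k + 1) (Nat.succ_le_succ h) x.1,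
    (congrArg (D.base k h.le) (hD.i_t _ (Nat.succ_le_succ h) x.1)).trans x.2⟩
  le k h x y := D.le (k + 1) (Nat.succ_le_succ h) x.1 y.1

/-- Over an inner cell of dimension one a disk restricts to a disk. Over the endpoints this fails:
the interval in the lowest dimension of the fiber degenerates. -/
theorem isDisk_fiber {n : ℕ} {D : DiskData.{w} (n + 1)} (hD : D.IsDisk)
    {d : D.cell 1 (Nat.le_add_left 1 n)} (hs : ∀ x, d ≠ D.s 0 n.succ_pos x)
    (ht : ∀ x, d ≠ D.t 0 n.succ_pos x) : (D.fiber hD d).IsDisk where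
  cell_zero := ⟨{ default := ⟨d, rfl⟩, uniq := fun x => Subtype.ext x.2 }⟩
  i_s k h x := Subtype.ext (hD.i_s _ _ _)
  i_t k h x := Subtype.ext (hD.i_t _ _ _)
  t_t k h x := Subtype.ext (hD.t_t _ (Nat.succ_lt_succ h) _)
  t_s k h x := Subtype.ext (hD.t_s _ (Nat.succ_lt_succ h) _)
  le_fiber k h x y hxy := Subtype.ext (hD.le_fiber _ _ _ _ hxy)
  le_refl k h x := hD.le_refl _ _ _
  le_trans k h x y z hxy hyz := hD.le_trans _ _ _ _ _ hxy hyz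
  le_antisymm k h x y hxy hyx := Subtype.ext (hD.le_antisymm _ _ _ _ hxy hyx)
  le_total k h x y hxy := hD.le_total _ _ _ _ (congrArg Subtype.val hxy)
  s_le k h x y hxy := hD.s_le _ _ _ _ (congrArg Subtype.val hxy)
  le_t k h x y hxy := hD.le_t _ _ _ _ (congrArg Subtype.val hxy)
  equalizer_zero h := by
    refine Set.eq_empty_of_forall_notMem fun ⟨x, hx⟩ he => ?_
    obtain rfl : x = d := hx
    rcases (hD.equalizer_succ 0 (Nat.succ_lt_succ h)).subset (congrArg Subtype.val he) with
      ⟨y, hy⟩ | ⟨y, hy⟩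
    · exact hs y hy.symm
    · exact ht y hy.symm
  equalizer_succ k h := by
    refine Set.Subset.antisymm ?_ ?_
    · intro x he
      rcases (hD.equalizer_succ (k + 1) (Nat.succ_lt_succ h)).subset (congrArg Subtype.val he) with
        ⟨y, hy⟩ | ⟨y, hy⟩
      · refine Or.inl ⟨⟨y, ?_⟩, Subtype.ext hy⟩
        rw [← x.2, ← hy]
        exact (congrArg (D.base k _) (hD.i_s (k + 1) _ y)).symm
      · refine Or.inr ⟨⟨y, ?_⟩, Subtype.ext hy⟩
        rw [← x.2, ← hy]
        exact (congrArg (D.base k _) (hD.i_t (k + 1) _ y)).symm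
    · rintro _ (⟨x, rfl⟩ | ⟨x, rfl⟩)
      · exact Subtype.ext (hD.t_s _ (Nat.succ_lt_succ h) _).symm
      · exact Subtype.ext (hD.t_t _ (Nat.succ_lt_succ h) _).symm

theorem isFiniteDisk_fiber {n : ℕ} {D : DiskData.{w} (n + 1)} (hD : D.IsFiniteDisk)
    {d : D.cell 1 (Nat.le_add_left 1 n)} (hs : ∀ x, d ≠ D.s 0 n.succ_pos x)
    (ht : ∀ x, d ≠ D.t 0 n.succ_pos x) : (D.fiber hD.toIsDisk d).IsFiniteDisk where
  __ := isDisk_fiber hD.toIsDisk hs ht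
  finite _ _ := @Subtype.finite _ (hD.finite _ _) _

/-- A cell lying over an endpoint of the interval in dimension one is degenerate. -/
theorem eq_s_i_of_base {n : ℕ} {D : DiskData.{w} (n + 1)} (hD : D.IsDisk) (k : ℕ) (h : k + 1 ≤ n)
    (x : D.cell (k + 2) (Nat.succ_le_succ h))
    (hx : (∃ z, D.base (k + 1) h x = D.s 0 n.succ_pos z) ∨
      ∃ z, D.base (k + 1) h x = D.t 0 n.succ_pos z) :
    x = D.s (k + 1) (Nat.succ_le_succ h) (D.i (k + 1) (Nat.succ_le_succ h) x) := by
  -- It suffices that the minimum and the maximum of the fiber agree.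
  suffices hst : D.s (k + 1) (Nat.succ_le_succ h) (D.i (k + 1) (Nat.succ_le_succ h) x) =
      D.t (k + 1) (Nat.succ_le_succ h) (D.i (k + 1) (Nat.succ_le_succ h) x) by
    refine hD.le_antisymm _ _ _ _ ?_ (hD.s_le _ _ _ _ rfl)
    rw [hst]
    exact hD.le_t _ _ _ _ rfl
  induction k with
  | zero =>
    change (∃ z, D.i 1 _ x = _) ∨ ∃ z, D.i 1 _ x = _ at hx
    obtain ⟨z, hz⟩ | ⟨z, hz⟩ := hx
    · rw [hz]
      exact (hD.t_s 0 _ z).symm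
    · rw [hz]
      exact (hD.t_t 0 _ z).symm
  | succ k ih =>
    have ih' := ih (Nat.le_of_succ_le h) (D.i (k + 2) (Nat.succ_le_succ h) x) hx
    have : D.i (k + 2) (Nat.succ_le_succ h) x = D.s (k + 1) (Nat.le_of_succ_le (Nat.succ_le_succ h))
        (D.i (k + 1) _ (D.i (k + 2) (Nat.succ_le_succ h) x)) := by
      refine hD.le_antisymm _ _ _ _ ?_ (hD.s_le _ _ _ _ rfl)
      rw [ih']
      exact hD.le_t _ _ _ _ rfl
    rw [this]
    exact (hD.t_s _ _ _).symm

/-- There is exactly one cell of each dimension over an endpoint of the interval in dimension one. -/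
theorem eq_of_base_eq {n : ℕ} {D : DiskData.{w} (n + 1)} (hD : D.IsDisk) (k : ℕ) (h : k ≤ n)
    (x y : D.cell (k + 1) (Nat.succ_le_succ h)) (hxy : D.base k h x = D.base k h y)
    (hx : (∃ z, D.base k h x = D.s 0 n.succ_pos z) ∨ ∃ z, D.base k h x = D.t 0 n.succ_pos z) :
    x = y := by
  induction k with
  | zero => exact hxy
  | succ k ih =>
    rw [eq_s_i_of_base hD k h x hx, eq_s_i_of_base hD k h y (hxy ▸ hx)]
    exact congrArg _ (ih _ _ _ hxy hx)

end DiskData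

/-- A finite linear order can be enumerated in decreasing order. -/
theorem exists_antitone_enum {I : Type w} [Finite I] (r : I → I → Prop) (hrefl : ∀ x, r x x)
    (htrans : ∀ x y z, r x y → r y z → r x z) (hanti : ∀ x y, r x y → r y x → x = y)
    (htotal : ∀ x y, r x y ∨ r y x) :
    ∃ (p : ℕ) (e : Fin p ≃ I), ∀ i j, i ≤ j ↔ r (e j) (e i) := by
  classical
  let _ : LinearOrder I :=
    { le := fun x y => r y x
      le_refl := hrefl
      le_trans := fun x y z h h' => htrans _ _ _ h' h
      le_antisymm := fun x y h h' => hanti _ _ h' h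
      le_total := fun x y => htotal _ _
      toDecidableLE := Classical.decRel _ }
  have := Fintype.ofFinite I
  exact ⟨_, (Fintype.orderIsoFinOfCardEq I rfl).toEquiv, fun i j =>
    (OrderIso.le_iff_le (Fintype.orderIsoFinOfCardEq I rfl)).symm⟩

/-! ### Every finite disk is the nerve of a tuple -/

namespace DiskShape

open WreathDelta

variable {A : Type u} [Category.{0} A] (X : DiskShape A)

/-- Every finite `(n + 1)`-disk is the nerve of the tuple whose terms correspond to the fibers
over the inner cells of dimension one. -/
theorem wreath_essSurj {n : ℕ} (H : X.IsDuality.{w} n) (D : DiskData.{w} (n + 1))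
    (hD : D.IsFiniteDisk) : ∃ S, Nonempty (X.wreath.nerve (n + 1) S ≅ D) := by
  classical
  have hD' := hD.toIsDisk
  obtain ⟨u⟩ := hD.cell_zero
  let lo := D.s 0 n.succ_pos u.default
  let hi := D.t 0 n.succ_pos u.default
  have h_lo : ∀ x, D.s 0 n.succ_pos x = lo := fun x => congrArg _ (u.uniq x)
  have h_hi : ∀ x, D.t 0 n.succ_pos x = hi := fun x => congrArg _ (u.uniq x)
  let le := D.le 0 n.succ_pos
  have h_total : ∀ x y, le x y ∨ le y x := fun x y =>
    hD.le_total 0 _ x y ((u.uniq _).trans (u.uniq _).symm)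
  have lo_le : ∀ x, le lo x := fun x => hD.s_le 0 _ _ x (u.uniq _)
  have le_hi : ∀ x, le x hi := fun x => hD.le_t 0 _ _ x (u.uniq _)
  have lo_ne_hi : lo ≠ hi := fun h => (hD.equalizer_zero n.succ_pos).subset h
  let I := {d : D.cell 1 (Nat.le_add_left 1 n) // d ≠ lo ∧ d ≠ hi}
  have : Finite I := @Subtype.finite _ (hD.finite _ _) _
  obtain ⟨p, e, he⟩ := exists_antitone_enum (I := I) (fun x y => le x.1 y.1)
    (fun x => hD.le_refl _ _ _) (fun x y z => hD.le_trans _ _ _ _ _)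
    (fun x y h h' => Subtype.ext (hD.le_antisymm _ _ _ _ h h')) (fun x y => h_total _ _)
  have hfib : ∀ i, (D.fiber hD' (e i).1).IsFiniteDisk := fun i =>
    DiskData.isFiniteDisk_fiber hD (fun x h => (e i).2.1 (h.trans (h_lo x)))
      (fun x h => (e i).2.2 (h.trans (h_hi x)))
  choose B hB using fun i => H.essSurj _ (hfib i)
  let ι : ∀ i, X.nerve n (B i) ≅ D.fiber hD' (e i).1 := fun i => (hB i).some
  let S : WreathDelta A := ⟨p, B⟩
  -- The operator `[p] ⟶ [1]` classifying a cell of dimension one.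
  let χ : D.cell 1 (Nat.le_add_left 1 n) → (SimplexCategory.mk p ⟶ SimplexCategory.mk 1) := fun b =>
    SimplexCategory.mkHom ⟨fun a =>
      if b ≠ lo ∧ ∀ i : Fin p, a ≤ i.castSucc → ¬ le b (e i).1 then 1 else 0, fun a a' h => by
        dsimp only
        split_ifs with h1 h2
        · exact le_rfl
        · exact absurd ⟨h1.1, fun i hi => h1.2 i (h.trans hi)⟩ h2
        · exact Fin.zero_le _
        · exact le_rfl⟩
  have χ_apply : ∀ b a, ((χ b).toOrderHom a : Fin 2) =
      if b ≠ lo ∧ ∀ i : Fin p, a ≤ i.castSucc → ¬ le b (e i).1 then 1 else 0 := fun b a => rfl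
  have χ_lo : ∀ a, ((χ lo).toOrderHom a : Fin 2) = 0 := fun a => by
    rw [χ_apply, if_neg fun h => h.1 rfl]
  have χ_hi : ∀ a, ((χ hi).toOrderHom a : Fin 2) = 1 := fun a => by
    rw [χ_apply, if_pos ⟨lo_ne_hi.symm, fun i _ h =>
      (e i).2.2 (hD.le_antisymm _ _ _ _ (le_hi _) h)⟩]
  have χ_e : ∀ j, χ (e j).1 = cut j := fun j => SimplexCategory.hom_ext_apply fun a => by
    rw [χ_apply, cut_apply]
    refine if_congr ⟨fun h => ?_, fun h => ⟨(e j).2.1, fun i hi hle => ?_⟩⟩ rfl rfl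
    · by_contra hn
      exact h.2 j (not_lt.1 hn) (hD.le_refl _ _ _)
    · exact absurd (h.trans_le hi) (not_lt.2 (Fin.castSucc_le_castSucc_iff.2 ((he _ _).2 hle)))
  have χ_mono : ∀ b b', le b b' → ∀ a, ((χ b).toOrderHom a : Fin 2) ≤ (χ b').toOrderHom a := by
    intro b b' h a
    rw [χ_apply, χ_apply]
    split_ifs with h1 h2
    · exact le_rfl
    · refine absurd ⟨?_, fun i hi hle => h1.2 i hi (hD.le_trans _ _ _ _ _ h hle)⟩ h2
      rintro rfl
      exact h1.1 (hD.le_antisymm _ _ _ _ h (lo_le _))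
    · exact Fin.zero_le _
    · exact le_rfl
  have h_cases : ∀ b, b = lo ∨ b = hi ∨ ∃ j, b = (e j).1 := fun b => by
    by_cases h1 : b = lo
    · exact Or.inl h1
    by_cases h2 : b = hi
    · exact Or.inr (Or.inl h2)
    · exact Or.inr (Or.inr ⟨e.symm ⟨b, h1, h2⟩, by rw [e.apply_symm_apply]⟩)
  have h_block : ∀ {b} {i : Fin p} {k : Fin 1}, InBlock (χ b) i k → b = (e i).1 := by
    intro b i k h
    rcases h_cases b with rfl | rfl | ⟨j, rfl⟩
    · exact (not_inBlock_of_const χ_lo _ _ h).elim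
    · exact (not_inBlock_of_const χ_hi _ _ h).elim
    · rw [χ_e] at h
      rw [inBlock_cut.1 h]
  have h_block' : ∀ (i : Fin p) (k : Fin 1), InBlock (χ (e i).1) i k := fun i k => by
    rw [χ_e]
    exact inBlock_cut.2 rfl
  have χ_inj : ∀ b b', χ b = χ b' → b = b' := by
    intro b b' h
    rcases h_cases b with rfl | rfl | ⟨j, rfl⟩
    · rcases h_cases b' with rfl | rfl | ⟨j', rfl⟩
      · rfl
      · have := χ_lo 0
        rw [h, χ_hi] at this
        exact (Fin.zero_ne_one this.symm).elim
      · exact h_block (k := 0) (by rw [h]; exact h_block' _ _)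
    · rcases h_cases b' with rfl | rfl | ⟨j', rfl⟩
      · have := χ_hi 0
        rw [h, χ_lo] at this
        exact (Fin.zero_ne_one this).elim
      · rfl
      · exact h_block (k := 0) (by rw [h]; exact h_block' _ _)
    · exact (h_block (k := 0) (by rw [← h]; exact h_block' _ _)).symm
  -- The map from `D` to the nerve of `S`.
  let Φ : ∀ k (hk : k ≤ n), D.cell (k + 1) (Nat.succ_le_succ hk) → (S ⟶ one (X.lin k)) :=
    fun k hk y => show Hom _ _ from ⟨χ (D.base k hk y), fun i _ h =>
      (DiskData.Hom.app (ι i).inv k hk ⟨y, h_block h⟩).down⟩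
  have Φ_base : ∀ k hk y, Hom.base (Φ k hk y) = χ (D.base k hk y) := fun _ _ _ => rfl
  have Φ_comp : ∀ k hk y i (j : Fin 1) (h : InBlock (χ (D.base k hk y)) i j),
      ULift.up (Hom.component (Φ k hk y) i j h) =
        DiskData.Hom.app (ι i).inv k hk ⟨y, h_block h⟩ := fun _ _ _ _ _ _ => rfl
  have base_s : ∀ k (hk : k < n) y, D.base (k + 1) hk (D.s (k + 1) (Nat.succ_lt_succ hk) y) =
      D.base k hk.le y := fun k hk y => congrArg (D.base k _) (hD.i_s _ _ y)
  have base_t : ∀ k (hk : k < n) y, D.base (k + 1) hk (D.t (k + 1) (Nat.succ_lt_succ hk) y) =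
      D.base k hk.le y := fun k hk y => congrArg (D.base k _) (hD.i_t _ _ y)
  have Φ_i : ∀ k (hk : k < n) y, Φ k hk.le (D.i (k + 1) (Nat.succ_lt_succ hk) y) =
      Φ (k + 1) hk y ≫ Theta.single (X.proj k) := by
    intro k hk y
    refine Eq.symm (comp_single_eq_iff.2 ⟨rfl, fun i j h h' => ?_⟩)
    exact congrArg ULift.down (DiskData.Hom.app_i (ι i).inv k hk ⟨y, h_block h⟩).symm
  have Φ_s : ∀ k (hk : k < n) y, Φ (k + 1) hk (D.s (k + 1) (Nat.succ_lt_succ hk) y) =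
      Φ k hk.le y ≫ Theta.single (X.src k) := by
    intro k hk y
    refine Eq.symm (comp_single_eq_iff.2 ⟨congrArg χ (base_s k hk y).symm, fun i j h h' => ?_⟩)
    exact congrArg ULift.down (DiskData.Hom.app_s (ι i).inv k hk ⟨y, h_block h⟩).symm
  have Φ_t : ∀ k (hk : k < n) y, Φ (k + 1) hk (D.t (k + 1) (Nat.succ_lt_succ hk) y) =
      Φ k hk.le y ≫ Theta.single (X.tgt k) := by
    intro k hk y
    refine Eq.symm (comp_single_eq_iff.2 ⟨congrArg χ (base_t k hk y).symm, fun i j h h' => ?_⟩)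
    exact congrArg ULift.down (DiskData.Hom.app_t (ι i).inv k hk ⟨y, h_block h⟩).symm
  have hu : ∀ i, Nonempty (Unique (S.obj i ⟶ X.lin 0)) :=
    fun i => unique_lin_zero (H.isFiniteDisk (S.obj i)).toIsDisk
  have hN : (X.wreath.nerve.{w} (n + 1) S).IsFiniteDisk :=
    X.isFiniteDisk_nerve_wreath fun i => H.isFiniteDisk (S.obj i)
  obtain ⟨z⟩ : Nonempty (S ⟶ (zero : WreathDelta A)) := inferInstance
  have Φ_s_zero : ∀ (y : S ⟶ X.wreath.lin 0) x, Φ 0 n.zero_le (D.s 0 n.succ_pos x) =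
      y ≫ X.wreath.src 0 := fun y x => by
    rw [h_lo]
    refine hom_ext_of_const (SimplexCategory.hom_ext_apply fun a => ?_) (not_inBlock_of_const χ_lo)
    exact (χ_lo a).trans (base_comp_wreath_src_zero X y a).symm
  have Φ_t_zero : ∀ (y : S ⟶ X.wreath.lin 0) x, Φ 0 n.zero_le (D.t 0 n.succ_pos x) =
      y ≫ X.wreath.tgt 0 := fun y x => by
    rw [h_hi]
    refine hom_ext_of_const (SimplexCategory.hom_ext_apply fun a => ?_) (not_inBlock_of_const χ_hi)
    exact (χ_hi a).trans (base_comp_wreath_tgt_zero X y a).symm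
  let F : D ⟶ X.wreath.nerve.{w} (n + 1) S := show DiskData.Hom _ _ from
    { app := fun k => match k with
        | 0 => fun _ _ => ⟨z⟩
        | k + 1 => fun hk y => ⟨Φ k (Nat.le_of_succ_le_succ hk) y⟩
      app_i := fun k => match k with
        | 0 => fun _ _ => congrArg ULift.up (Subsingleton.elim (α := S ⟶ zero) _ _)
        | k + 1 => fun hk y => congrArg ULift.up (Φ_i k (Nat.lt_of_succ_lt_succ hk) y)
      app_s := fun k => match k with
        | 0 => fun _ y => congrArg ULift.up (Φ_s_zero z y)
        | k + 1 => fun hk y => congrArg ULift.up (Φ_s k (Nat.lt_of_succ_lt_succ hk) y)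
      app_t := fun k => match k with
        | 0 => fun _ y => congrArg ULift.up (Φ_t_zero z y)
        | k + 1 => fun hk y => congrArg ULift.up (Φ_t k (Nat.lt_of_succ_lt_succ hk) y)
      app_le := fun k => match k with
        | 0 => fun hk x y h => (wreath_le_zero X hu hk _ _).2 (χ_mono x y h)
        | k + 1 => fun hk x y h => by
          refine (wreath_le_succ X hk _ _).2 ⟨congrArg χ (congrArg (D.base k _)
            (hD.le_fiber _ _ _ _ h)), fun i j hx hy => ?_⟩
          exact DiskData.Hom.app_le (ι i).inv k (Nat.lt_of_succ_lt_succ hk) ⟨x, h_block hx⟩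
            ⟨y, h_block hy⟩ h }
  have hF_inj : ∀ k (hk : k ≤ n + 1), Function.Injective (DiskData.Hom.app F k hk) := by
    intro k hk x y hxy
    cases k with
    | zero => exact (u.uniq x).trans (u.uniq y).symm
    | succ k =>
      have h : Φ k (Nat.le_of_succ_le_succ hk) x = Φ k (Nat.le_of_succ_le_succ hk) y :=
        congrArg ULift.down hxy
      have hb := χ_inj _ _ (congrArg Hom.base h)
      rcases h_cases (D.base k (Nat.le_of_succ_le_succ hk) x) with h1 | h1 | ⟨j, h1⟩
      · exact DiskData.eq_of_base_eq hD' k _ x y hb (Or.inl ⟨_, h1⟩)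
      · exact DiskData.eq_of_base_eq hD' k _ x y hb (Or.inr ⟨_, h1⟩)
      · have hx : InBlock (Hom.base (Φ k (Nat.le_of_succ_le_succ hk) x)) j 0 := by
          rw [Φ_base, h1]
          exact h_block' _ _
        have hy : InBlock (Hom.base (Φ k (Nat.le_of_succ_le_succ hk) y)) j 0 := h ▸ hx
        have hc := congrArg (DiskData.Hom.app (ι j).hom k (Nat.le_of_succ_le_succ hk))
          (congrArg ULift.up (component_congr h hx hy))
        erw [Φ_comp, Φ_comp, DiskData.inv_hom_app, DiskData.inv_hom_app] at hc
        exact congrArg Subtype.val hc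
  have hF_surj : ∀ k (hk : k ≤ n + 1), Function.Surjective (DiskData.Hom.app F k hk) := by
    intro k
    induction k with
    | zero =>
      exact fun _ x => ⟨u.default, congrArg ULift.up (Subsingleton.elim (α := S ⟶ zero) _ _)⟩
    | succ k ih =>
      rintro hk ⟨x⟩
      change S ⟶ one (X.lin k) at x
      have hk' := Nat.le_of_succ_le_succ hk
      rcases exists_inBlock_or_const (Hom.base x) with ⟨j, hj⟩ | h | h
      · let y := DiskData.Hom.app (ι j).hom k hk' ⟨Hom.component x j 0 hj⟩
        refine ⟨y.1, congrArg ULift.up ?_⟩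
        have hy : D.base k hk' y.1 = (e j).1 := y.2
        have hb : Hom.base (Φ k hk' y.1) = Hom.base x := by
          rw [Φ_base, hy, χ_e, hj.eq_cut]
        refine WreathDelta.hom_ext hb fun i l hi hi' => ?_
        obtain rfl : i = j := hi'.unique (k := l) (Subsingleton.elim (α := Fin 1) 0 l ▸ hj)
        obtain rfl : l = 0 := Subsingleton.elim (α := Fin 1) _ _
        exact congrArg ULift.down (DiskData.hom_inv_app (ι i) k hk' ⟨Hom.component x i 0 hj⟩)
      · obtain ⟨y, hy⟩ := ih (Nat.le_of_succ_le hk)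
          ⟨(show S ⟶ X.wreath.lin (k + 1) from x) ≫ X.wreath.proj k⟩
        refine ⟨D.s k hk y, ?_⟩
        rw [DiskData.Hom.app_s, hy]
        exact congrArg ULift.up ((Category.assoc _ _ _).trans (eq_comp_src_of_const X x h).symm)
      · obtain ⟨y, hy⟩ := ih (Nat.le_of_succ_le hk)
          ⟨(show S ⟶ X.wreath.lin (k + 1) from x) ≫ X.wreath.proj k⟩
        refine ⟨D.t k hk y, ?_⟩
        rw [DiskData.Hom.app_t, hy]
        exact congrArg ULift.up ((Category.assoc _ _ _).trans (eq_comp_tgt_of_const X x h).symm)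
  have := DiskData.isIso_of_bijective F (fun k hk => ⟨hF_inj k hk, hF_surj k hk⟩)
    (DiskData.le_of_app_le hD' hN.toIsDisk F hF_inj)
  exact ⟨S, ⟨(asIso F).symm⟩⟩

/-- The duality between `A` and finite `n`-disks induces one between `Δ ≀ A` and finite
`(n + 1)`-disks. -/
theorem IsDuality.wreath {n : ℕ} {X : DiskShape A} (H : X.IsDuality.{w} n) :
    X.wreath.IsDuality.{w} (n + 1) where
  isFiniteDisk S := X.isFiniteDisk_nerve_wreath fun i => H.isFiniteDisk (S.obj i)
  faithful := X.wreath_faithful H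
  full φ := wreath_full φ H
  essSurj := X.wreath_essSurj H

end DiskShape

/-! ### The duality for `Θ_n` -/

namespace DiskData

theorem IsDisk.of_iso {n : ℕ} {D E : DiskData.{w} n} (e : D ≅ E) (hE : E.IsDisk) : D.IsDisk := by
  have inj : ∀ k (h : k ≤ n), Function.Injective (Hom.app e.hom k h) :=
    fun k h => Function.LeftInverse.injective (g := Hom.app e.inv k h) (hom_inv_app e k h)
  have le_iff : ∀ k (h : k < n) x y,
      D.le k h x y ↔ E.le k h (Hom.app e.hom _ h x) (Hom.app e.hom _ h y) := fun k h x y =>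
    ⟨Hom.app_le e.hom k h x y, fun hxy => by
      simpa only [hom_inv_app] using Hom.app_le e.inv k h _ _ hxy⟩
  have i_s : ∀ k (h : k < n) x, D.i k h (D.s k h x) = x := fun k h x => inj _ _ (by
    rw [Hom.app_i, Hom.app_s, hE.i_s])
  have i_t : ∀ k (h : k < n) x, D.i k h (D.t k h x) = x := fun k h x => inj _ _ (by
    rw [Hom.app_i, Hom.app_t, hE.i_t])
  have app_i : ∀ k (h : k < n) x y, D.i k h x = D.i k h y ↔
      E.i k h (Hom.app e.hom _ h x) = E.i k h (Hom.app e.hom _ h y) := fun k h x y => by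
    rw [← Hom.app_i, ← Hom.app_i, (inj _ _).eq_iff]
  have app_st : ∀ k (h : k < n) x, D.s k h x = D.t k h x ↔
      E.s k h (Hom.app e.hom _ _ x) = E.t k h (Hom.app e.hom _ _ x) := fun k h x => by
    rw [← Hom.app_s, ← Hom.app_t, (inj _ _).eq_iff]
  exact
  { cell_zero := by
      obtain ⟨u⟩ := hE.cell_zero
      exact ⟨{ default := Hom.app e.inv _ _ u.default
               uniq := fun x => inj _ _ ((u.uniq _).trans (u.uniq _).symm) }⟩
    i_s := i_s
    i_t := i_t
    t_t := fun k h x => Eq.symm ((app_st _ _ _).2 (by rw [Hom.app_t, hE.t_t]))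
    t_s := fun k h x => Eq.symm ((app_st _ _ _).2 (by rw [Hom.app_s, hE.t_s]))
    le_fiber := fun k h x y hxy => (app_i _ _ _ _).2 (hE.le_fiber _ _ _ _ ((le_iff _ _ _ _).1 hxy))
    le_refl := fun k h x => (le_iff _ _ _ _).2 (hE.le_refl _ _ _)
    le_trans := fun k h x y z => by
      simp only [le_iff]
      exact hE.le_trans _ _ _ _ _
    le_antisymm := fun k h x y hxy hyx =>
      inj _ _ (hE.le_antisymm _ _ _ _ ((le_iff _ _ _ _).1 hxy) ((le_iff _ _ _ _).1 hyx))
    le_total := fun k h x y => by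
      simp only [le_iff, app_i]
      exact hE.le_total _ _ _ _
    s_le := by
      rintro k h _ y rfl
      rw [le_iff, Hom.app_s, Hom.app_i]
      exact hE.s_le _ _ _ _ rfl
    le_t := by
      rintro k h _ y rfl
      rw [le_iff, Hom.app_t, Hom.app_i]
      exact hE.le_t _ _ _ _ rfl
    equalizer_zero := fun h => Set.eq_empty_of_forall_notMem fun x hx =>
      (hE.equalizer_zero h).subset ((app_st _ _ _).1 hx)
    equalizer_succ := fun k h => by
      refine Set.ext fun x => (app_st _ _ _).trans (((Set.ext_iff.1 (hE.equalizer_succ k h) _)).trans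
        (or_congr ?_ ?_))
      · constructor
        · rintro ⟨y, hy⟩
          exact ⟨Hom.app e.inv _ _ y, inj _ _ (by rw [Hom.app_s, inv_hom_app, hy])⟩
        · rintro ⟨y, rfl⟩
          exact ⟨_, (Hom.app_s _ _ _ _).symm⟩
      · constructor
        · rintro ⟨y, hy⟩
          exact ⟨Hom.app e.inv _ _ y, inj _ _ (by rw [Hom.app_t, inv_hom_app, hy])⟩
        · rintro ⟨y, rfl⟩
          exact ⟨_, (Hom.app_t _ _ _ _).symm⟩ }

theorem IsFiniteDisk.of_iso {n : ℕ} {D E : DiskData.{w} n} (e : D ≅ E) (hE : E.IsFiniteDisk) :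
    D.IsFiniteDisk where
  __ := IsDisk.of_iso e hE.toIsDisk
  finite k h := @Finite.of_injective _ _ (hE.finite k h) _
    (Function.LeftInverse.injective (g := Hom.app e.inv k h) (hom_inv_app e k h))

end DiskData

namespace DiskShape

/-- A duality can be transported along an equivalence of categories compatible with nerves. -/
theorem IsDuality.of_equivalence {A : Type u} [Category.{0} A] {B : Type v} [Category.{0} B]
    {X : DiskShape A} {Y : DiskShape B} {n : ℕ} (H : Y.IsDuality.{w} n) (Φ : A ⥤ B)
    [Φ.IsEquivalence] (ι : ∀ T, X.nerve.{w} n T ≅ Y.nerve n (Φ.obj T))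
    (hι : ∀ {S T : A} (f : S ⟶ T),
      (ι T).hom ≫ Y.nerveMap n (Φ.map f) = X.nerveMap n f ≫ (ι S).hom) : X.IsDuality.{w} n where
  isFiniteDisk T := (H.isFiniteDisk (Φ.obj T)).of_iso (ι T)
  faithful {S T} f g h := by
    have e : X.nerveMap.{w} n f = X.nerveMap n g := DiskData.hom_ext fun k hk x =>
      congrArg ULift.up (h k hk x.down)
    refine Φ.map_injective (H.faithful _ _ fun k hk x => ?_)
    have : Y.nerveMap.{w} n (Φ.map f) = Y.nerveMap n (Φ.map g) := by
      rw [← cancel_epi (ι T).hom, hι, hι, e]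
    exact congrArg (fun q : Y.nerve.{w} n (Φ.obj T) ⟶ Y.nerve n (Φ.obj S) =>
      (DiskData.Hom.app q k hk ⟨x⟩).down) this
  full {S T} φ := by
    obtain ⟨f, hf⟩ := H.full ((ι T).inv ≫ φ ≫ (ι S).hom)
    refine ⟨Φ.preimage f, ?_⟩
    rw [← cancel_mono (ι S).hom, ← hι, Φ.map_preimage, hf, Iso.hom_inv_id_assoc]
  essSurj D hD := by
    obtain ⟨T, ⟨e⟩⟩ := H.essSurj D hD
    let a := Φ.objObjPreimageIso T
    let b : Y.nerve.{w} n (Φ.obj (Φ.objPreimage T)) ≅ Y.nerve n T :=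
      { hom := Y.nerveMap n a.inv
        inv := Y.nerveMap n a.hom
        hom_inv_id := DiskData.hom_ext fun k hk x => congrArg ULift.up (a.hom_inv_id_assoc x.down)
        inv_hom_id := DiskData.hom_ext fun k hk x => congrArg ULift.up (a.inv_hom_id_assoc x.down) }
    exact ⟨Φ.objPreimage T, ⟨ι _ ≪≫ b ≪≫ e⟩⟩

end DiskShape

namespace Theta

open WreathDelta

/-- The linear level-trees and forks in `Θ_n`. -/
noncomputable def shape (n : ℕ) : DiskShape (Theta n) where
  lin := lin n
  fork := fork n
  proj := proj n
  src := src n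
  tgt := tgt n
  deg₀ := deg₀ n
  deg₁ := deg₁ n

theorem shape_succ (n : ℕ) : shape (n + 2) = (shape (n + 1)).wreath := by
  refine DiskShape.ext_of_heq ?_ ?_ ?_ ?_ ?_ ?_ ?_ <;> rintro (_ | k) <;> rfl

instance (X Y : Theta 0) : Subsingleton (X ⟶ Y) :=
  (fun X Y : Discrete PUnit => (inferInstance : Subsingleton (X ⟶ Y))) X Y

theorem isDuality_shape_zero : (shape 0).IsDuality.{w} 0 := by
  have hu : ∀ T : Theta 0, Nonempty (Unique (ULift.{w} (T ⟶ (shape 0).lin 0))) := fun T =>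
    ⟨{ default := ⟨𝟙 (⟨⟨⟩⟩ : Discrete PUnit)⟩
       uniq := fun x => congrArg ULift.up (Subsingleton.elim _ _) }⟩
  exact
  { isFiniteDisk := fun T =>
      { cell_zero := hu T
        i_s := fun k h => absurd h (Nat.not_lt_zero k)
        i_t := fun k h => absurd h (Nat.not_lt_zero k)
        t_t := fun k h => absurd h (Nat.not_lt_zero _)
        t_s := fun k h => absurd h (Nat.not_lt_zero _)
        le_fiber := fun k h => absurd h (Nat.not_lt_zero k)
        le_refl := fun k h => absurd h (Nat.not_lt_zero k)
        le_trans := fun k h => absurd h (Nat.not_lt_zero k)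
        le_antisymm := fun k h => absurd h (Nat.not_lt_zero k)
        le_total := fun k h => absurd h (Nat.not_lt_zero k)
        s_le := fun k h => absurd h (Nat.not_lt_zero k)
        le_t := fun k h => absurd h (Nat.not_lt_zero k)
        equalizer_zero := fun h => absurd h (Nat.not_lt_zero 0)
        equalizer_succ := fun k h => absurd h (Nat.not_lt_zero _)
        finite := fun k h => by
          obtain rfl := Nat.le_zero.1 h
          obtain ⟨u⟩ := hu T
          exact Finite.of_subsingleton (α := ULift.{w} (T ⟶ (shape 0).lin 0)) }
    faithful := fun f g _ => Subsingleton.elim f g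
    full := fun {S T} φ => ⟨𝟙 (⟨⟨⟩⟩ : Discrete PUnit), DiskData.hom_ext fun k h x =>
      congrArg ULift.up (Subsingleton.elim (α := S ⟶ lin 0 k) _ _)⟩
    essSurj := fun D hD => by
      obtain ⟨u⟩ := hD.cell_zero
      obtain ⟨v⟩ := hu (⟨⟨⟩⟩ : Discrete PUnit)
      have : ∀ k, k ≤ 0 → k = 0 := fun k => Nat.le_zero.1
      refine ⟨(⟨⟨⟩⟩ : Discrete PUnit), ⟨⟨show DiskData.Hom _ _ from ⟨fun k h _ => ?_,
        fun k h => absurd h (Nat.not_lt_zero k), fun k h => absurd h (Nat.not_lt_zero k),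
        fun k h => absurd h (Nat.not_lt_zero k), fun k h => absurd h (Nat.not_lt_zero k)⟩,
        show DiskData.Hom _ _ from ⟨fun k h _ => ⟨𝟙 (⟨⟨⟩⟩ : Discrete PUnit)⟩,
        fun k h => absurd h (Nat.not_lt_zero k), fun k h => absurd h (Nat.not_lt_zero k),
        fun k h => absurd h (Nat.not_lt_zero k), fun k h => absurd h (Nat.not_lt_zero k)⟩,
        DiskData.hom_ext fun k h x => ?_, DiskData.hom_ext fun k h x => ?_⟩⟩⟩
      · obtain rfl := this k h
        exact u.default
      · exact congrArg ULift.up (Subsingleton.elim (α := (⟨⟨⟩⟩ : Discrete PUnit) ⟶ ⟨⟨⟩⟩) _ _)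
      · obtain rfl := this k h
        exact (u.uniq _).trans (u.uniq _).symm }

/-- `Δ` is the wreath product of `Δ` with the one-point category. -/
def simplexToWreath : SimplexCategory ⥤ WreathDelta (Theta 0) where
  obj T := ⟨T.len, fun _ => (⟨⟨⟩⟩ : Discrete PUnit)⟩
  map f := show Hom _ _ from ⟨f, fun _ _ _ => 𝟙 (⟨⟨⟩⟩ : Discrete PUnit)⟩
  map_id _ := WreathDelta.hom_ext rfl fun _ _ _ _ => Subsingleton.elim _ _
  map_comp _ _ := WreathDelta.hom_ext rfl fun _ _ _ _ => Subsingleton.elim _ _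

theorem wreath_hom_ext {S T : WreathDelta (Theta 0)} {f g : S ⟶ T} (h : Hom.base f = Hom.base g) :
    f = g := WreathDelta.hom_ext h fun _ _ _ _ => Subsingleton.elim _ _

instance : simplexToWreath.IsEquivalence where
  faithful := ⟨fun h => congrArg Hom.base h⟩
  full := ⟨fun f => ⟨Hom.base f, wreath_hom_ext rfl⟩⟩
  essSurj := ⟨fun ⟨m, _⟩ => ⟨SimplexCategory.mk m, ⟨Iso.refl _⟩⟩⟩

/-- A morphism of `Δ ≀ Θ₀` is a map of `Δ`. -/
def wreathOfBase {S T : WreathDelta (Theta 0)}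
    (f : SimplexCategory.mk S.len ⟶ SimplexCategory.mk T.len) : S ⟶ T :=
  show Hom _ _ from ⟨f, fun _ _ _ => 𝟙 (⟨⟨⟩⟩ : Discrete PUnit)⟩

/-- The shape in `Θ₁`, with `SimplexCategory` in place of the carrier of `Theta 1`, to which it is
equal by definition. -/
noncomputable def simplexShape : DiskShape SimplexCategory := shape 1

/-- The comparison of nerves in `Δ` and in `Δ ≀ Θ₀`: in dimensions `0` and `1`, the linear trees and
forks of both have the same underlying objects of `Δ`. -/
noncomputable def nerveSimplexHom (T : SimplexCategory) :
    simplexShape.nerve.{w} 1 T ⟶ (shape 0).wreath.nerve 1 (simplexToWreath.obj T) :=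
  show DiskData.Hom _ _ from
  { app := fun k => match k with
      | 0 => fun _ x => ⟨wreathOfBase x.down⟩
      | k + 1 => fun _ x => ⟨wreathOfBase x.down⟩
    app_i := fun k => match k with
      | 0 => fun _ x => congrArg ULift.up (wreath_hom_ext rfl)
      | k + 1 => fun h => absurd h (by omega)
    app_s := fun k => match k with
      | 0 => fun _ x => congrArg ULift.up (wreath_hom_ext rfl)
      | k + 1 => fun h => absurd h (by omega)
    app_t := fun k => match k with
      | 0 => fun _ x => congrArg ULift.up (wreath_hom_ext rfl)
      | k + 1 => fun h => absurd h (by omega)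
    app_le := fun k => match k with
      | 0 => by
        rintro _ _ _ ⟨z, rfl, rfl⟩
        exact ⟨⟨wreathOfBase z.down⟩, congrArg ULift.up (wreath_hom_ext rfl),
          congrArg ULift.up (wreath_hom_ext rfl)⟩
      | k + 1 => fun h => absurd h (by omega) }

theorem isIso_nerveSimplexHom (T : SimplexCategory) : IsIso (nerveSimplexHom.{w} T) := by
  refine DiskData.isIso_of_bijective _ (fun k h => ⟨fun x y hxy => ?_, fun x => ?_⟩)
    fun k h x y hxy => ?_
  · cases k <;> exact congrArg (fun z => ULift.up (Hom.base z.down)) hxy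
  · cases k <;> exact ⟨⟨Hom.base x.down⟩, congrArg ULift.up (wreath_hom_ext rfl)⟩
  · obtain rfl : k = 0 := by omega
    obtain ⟨z, hx, hy⟩ := hxy
    exact ⟨⟨Hom.base z.down⟩, congrArg (fun z => ULift.up (Hom.base z.down)) hx,
      congrArg (fun z => ULift.up (Hom.base z.down)) hy⟩

theorem isDuality_simplexShape : simplexShape.IsDuality.{w} 1 := by
  refine isDuality_shape_zero.wreath.of_equivalence simplexToWreath
    (fun T => @asIso _ _ _ _ (nerveSimplexHom T) (isIso_nerveSimplexHom T))
    fun {S T} f => DiskData.hom_ext fun k hk x => ?_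
  cases k <;> exact congrArg ULift.up (wreath_hom_ext rfl)

theorem isDuality_shape (n : ℕ) : (shape n).IsDuality.{w} n := by
  match n with
  | 0 => exact isDuality_shape_zero
  | 1 => exact isDuality_simplexShape
  | n + 2 =>
    rw [shape_succ]
    exact (isDuality_shape (n + 1)).wreath

/-- Isomorphic tuples of objects of a skeletal category are equal. -/
theorem skeletal_wreathDelta {A : Type u} [Category.{v} A] (hA : Skeletal A) :
    Skeletal (WreathDelta A) := by
  rintro ⟨m, B⟩ ⟨p, C⟩ ⟨e⟩
  let b : SimplexCategory.mk m ≅ SimplexCategory.mk p :=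
    { hom := Hom.base e.hom
      inv := Hom.base e.inv
      hom_inv_id := congrArg Hom.base e.hom_inv_id
      inv_hom_id := congrArg Hom.base e.inv_hom_id }
  obtain rfl : m = p := congrArg SimplexCategory.len (SimplexCategory.skeletal ⟨b⟩)
  have h1 : Hom.base e.hom = 𝟙 _ := @SimplexCategory.eq_id_of_isIso _ b.hom (Iso.isIso_hom b)
  have h2 : Hom.base e.inv = 𝟙 _ := @SimplexCategory.eq_id_of_isIso _ b.inv (Iso.isIso_inv b)
  have k1 : ∀ i : Fin m, InBlock (Hom.base e.hom) i i := fun i => by rw [h1]; exact inBlock_id.2 rfl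
  have k2 : ∀ i : Fin m, InBlock (Hom.base e.inv) i i := fun i => by rw [h2]; exact inBlock_id.2 rfl
  have k3 : ∀ i : Fin m, InBlock (𝟙 (SimplexCategory.mk m)) i i := fun i => inBlock_id.2 rfl
  refine congrArg _ (funext fun i => hA ⟨⟨Hom.component e.hom i i (k1 i),
    Hom.component e.inv i i (k2 i), ?_, ?_⟩⟩)
  · exact (comp_component e.hom e.inv ((k1 i).comp (k2 i)) (k1 i) (k2 i)).symm.trans
      (component_congr e.hom_inv_id _ (k3 i))
  · exact (comp_component e.inv e.hom ((k2 i).comp (k1 i)) (k2 i) (k1 i)).symm.trans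
      (component_congr e.inv_hom_id _ (k3 i))

theorem skeletal (n : ℕ) : Skeletal (Theta n) := by
  match n with
  | 0 => exact fun X Y _ => Subsingleton.elim (α := Discrete PUnit) X Y
  | 1 => exact SimplexCategory.skeletal
  | n + 2 => exact skeletal_wreathDelta (skeletal (n + 1))

end Theta

/-! ### Flat functors and filtered colimits of corepresentable functors -/

section Flat

open Limits Opposite

variable {A : Type} [SmallCategory A] {F : A ⥤ Type w}

/-- The fiber functor of a point of the trivial site, i.e. the filtered colimit of the evaluations
at the elements of `F`, is a left Kan extension of `F` along the Yoneda embedding. -/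
theorem isFlat_of_isCofiltered (h : IsCofiltered F.Elements) : IsFlat F := by
  have : EssentiallySmall.{w} A := EssentiallySmall.mk' (AsSmall.equiv : A ≌ AsSmall.{w} A)
  have := initiallySmall_of_essentiallySmall.{w} F.Elements
  let P : GrothendieckTopology.Point.{w} (⊥ : GrothendieckTopology A) :=
    { fiber := F
      jointly_surjective := fun {X} R hR x =>
        ⟨X, 𝟙 X, by rw [GrothendieckTopology.bot_covering.1 hR]; trivial, x, by simp⟩ }
  let L := P.presheafFiber (A := Type w)
  let e : F ≅ uliftYoneda.{w} ⋙ L := P.shrinkYonedaCompPresheafFiberIso.symm ≪≫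
    Functor.isoWhiskerRight uliftYonedaIsoShrinkYoneda.{w}.symm L
  have : PreservesColimitsOfSize.{w, w} L := inferInstance
  have : PreservesColimitsOfSize.{0, w} L := preservesColimitsOfSize_of_univLE.{w, w, 0, w} L
  have : PreservesFiniteLimits L := inferInstance
  let i := Presheaf.uniqueExtensionAlongULiftYoneda.{w} L e
  exact preservesFiniteLimits_of_natIso i

/-- The left Kan extension `L` is left exact, so its category of elements is cofiltered. It also
preserves colimits, so every element of `L` comes from an element of `F`, and a cone in the elements
of `L` can be refined to one in the elements of `F`. -/
theorem IsFlat.isCofiltered (h : IsFlat F) : IsCofiltered F.Elements := by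
  let L := uliftYoneda.{w}.leftKanExtension F
  have : PreservesFiniteLimits L := h
  have hL : IsCofiltered L.Elements := Functor.isCofiltered_elements L
  have : PreservesColimitsOfSize.{0, w} L :=
    Presheaf.preservesColimitsOfSize_leftKanExtension.{w} F
  let η := uliftYoneda.{w}.leftKanExtensionUnit F
  have : IsIso η := Presheaf.isIso_of_isLeftKanExtension.{w} L η
  have hη : ∀ T, Function.Bijective (η.app T) := fun T =>
    (isIso_iff_bijective _).1 inferInstance
  have hnat : ∀ {S T : A} (f : S ⟶ T) (x : F.obj S),
      η.app T (F.map f x) = L.map (uliftYoneda.{w}.map f) (η.app S x) := fun f x =>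
    NatTrans.naturality_apply η f x
  -- Every element of `L` comes from an element of `F`.
  have hsurj : ∀ (p : L.Elements), ∃ (T : A) (x : F.obj T) (f : uliftYoneda.{w}.obj T ⟶ p.1),
      L.map f (η.app T x) = p.2 := by
    rintro ⟨P, y⟩
    obtain ⟨q, z, hz⟩ := Types.jointly_surjective_of_isColimit
      (isColimitOfPreserves L (Presheaf.colimitOfRepresentable.{w} P)) y
    obtain ⟨x, hx⟩ := (hη q.unop.1.unop).2 z
    exact ⟨q.unop.1.unop, x, (Presheaf.coconeOfRepresentable P).ι.app q, by rw [hx]; exact hz⟩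
  have hfull : ∀ {S T : A} (g : uliftYoneda.{w}.obj S ⟶ uliftYoneda.{w}.obj T),
      ∃ f : S ⟶ T, uliftYoneda.{w}.map f = g := fun g => uliftYoneda.{w}.map_surjective g
  let ι : F.Elements → L.Elements := fun x => ⟨uliftYoneda.{w}.obj x.1, η.app _ x.2⟩
  exact
  { nonempty := by
      obtain ⟨p⟩ := hL.nonempty
      obtain ⟨T, x, -⟩ := hsurj p
      exact ⟨⟨T, x⟩⟩
    cone_objs := fun x y => by
      let z := IsCofiltered.min (ι x) (ι y)
      obtain ⟨S, u, p, hp⟩ := hsurj z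
      obtain ⟨f, hf⟩ := hfull (p ≫ (IsCofiltered.minToLeft (ι x) (ι y)).1)
      obtain ⟨g, hg⟩ := hfull (p ≫ (IsCofiltered.minToRight (ι x) (ι y)).1)
      refine ⟨⟨S, u⟩, ⟨f, (hη _).1 ?_⟩, ⟨g, (hη _).1 ?_⟩, trivial⟩
      · rw [hnat, hf, L.map_comp, comp_apply, hp]
        exact (IsCofiltered.minToLeft (ι x) (ι y)).2
      · rw [hnat, hg, L.map_comp, comp_apply, hp]
        exact (IsCofiltered.minToRight (ι x) (ι y)).2
    cone_maps := fun x y f g => by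
      let f' : ι x ⟶ ι y := ⟨uliftYoneda.{w}.map f.1, by rw [← hnat, f.2]⟩
      let g' : ι x ⟶ ι y := ⟨uliftYoneda.{w}.map g.1, by rw [← hnat, g.2]⟩
      obtain ⟨S, u, p, hp⟩ := hsurj (IsCofiltered.eq f' g')
      obtain ⟨h, hh⟩ := hfull (p ≫ (IsCofiltered.eqHom f' g').1)
      refine ⟨⟨S, u⟩, ⟨h, (hη _).1 ?_⟩, ?_⟩
      · rw [hnat, hh, L.map_comp, comp_apply, hp]
        exact (IsCofiltered.eqHom f' g').2
      · refine CategoryOfElements.ext _ _ _ (uliftYoneda.{w}.map_injective ?_)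
        have := congrArg Subtype.val (IsCofiltered.eq_condition f' g')
        change uliftYoneda.{w}.map (h ≫ f.1) = uliftYoneda.{w}.map (h ≫ g.1)
        rw [Functor.map_comp, Functor.map_comp, hh, Category.assoc, Category.assoc]
        exact congrArg (p ≫ ·) this }

end Flat

/-! ### The disk of a flat functor -/

namespace DiskShape

variable {A : Type} [SmallCategory A] (X : DiskShape A) (n : ℕ)

/-- Restriction of a functor to a shape. -/
def restrict : (A ⥤ Type w) ⥤ DiskData.{w} n where
  obj F :=
    { cell := fun k _ => F.obj (X.lin k)
      i := fun k _ => F.map (X.proj k)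
      s := fun k _ => F.map (X.src k)
      t := fun k _ => F.map (X.tgt k)
      le := fun k _ x y => ∃ z, F.map (X.deg₀ k) z = x ∧ F.map (X.deg₁ k) z = y }
  map {F G} α := show DiskData.Hom _ _ from
    { app := fun k _ => α.app (X.lin k)
      app_i := fun k _ x => NatTrans.naturality_apply α _ x
      app_s := fun k _ x => NatTrans.naturality_apply α _ x
      app_t := fun k _ x => NatTrans.naturality_apply α _ x
      app_le := by
        rintro k _ _ _ ⟨z, rfl, rfl⟩
        exact ⟨α.app _ z, (NatTrans.naturality_apply α _ z).symm,
          (NatTrans.naturality_apply α _ z).symm⟩ }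

/-- The functor `restrictLin` is the restriction to the linear level-trees and forks of `Θ_n`. -/
theorem restrict_shape (n : ℕ) : restrictLin.{w} n = (Theta.shape n).restrict n := rfl

variable {X n}

/-- The map of disk data corresponding to an element of a functor by the Yoneda lemma. -/
def ofElement {F : A ⥤ Type w} {T : A} (x : F.obj T) : X.nerve.{w} n T ⟶ (X.restrict n).obj F :=
  show DiskData.Hom _ _ from
  { app := fun _ _ c => F.map c.down x
    app_i := fun _ _ c => F.map_comp_apply _ _ _
    app_s := fun _ _ c => F.map_comp_apply _ _ _
    app_t := fun _ _ c => F.map_comp_apply _ _ _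
    app_le := by
      rintro k _ _ _ ⟨z, rfl, rfl⟩
      exact ⟨F.map z.down x, (F.map_comp_apply _ _ _).symm, (F.map_comp_apply _ _ _).symm⟩ }

theorem ofElement_app {F : A ⥤ Type w} {T : A} (x : F.obj T) (k : ℕ) (h : k ≤ n)
    (c : T ⟶ X.lin k) : DiskData.Hom.app (ofElement (X := X) (n := n) x) k h ⟨c⟩ = F.map c x := rfl

theorem nerveMap_ofElement {F : A ⥤ Type w} {S T : A} (f : S ⟶ T) (x : F.obj S) :
    X.nerveMap n f ≫ ofElement x = ofElement (F.map f x) :=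
  DiskData.hom_ext fun _ _ _ => F.map_comp_apply _ _ _

theorem ofElement_map {F G : A ⥤ Type w} (α : F ⟶ G) {T : A} (x : F.obj T) :
    ofElement x ≫ (X.restrict n).map α = ofElement (α.app T x) :=
  DiskData.hom_ext fun _ _ _ => NatTrans.naturality_apply α _ _

section Cofiltered

variable {F : A ⥤ Type w} [IsCofiltered F.Elements]

theorem exists_common {S T : A} (x : F.obj S) (y : F.obj T) :
    ∃ (U : A) (u : F.obj U) (f : U ⟶ S) (g : U ⟶ T), F.map f u = x ∧ F.map g u = y := by
  obtain ⟨⟨U, u⟩, f, g, -⟩ := IsCofilteredOrEmpty.cone_objs (C := F.Elements) ⟨S, x⟩ ⟨T, y⟩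
  exact ⟨U, u, f.1, g.1, f.2, g.2⟩

theorem exists_equalizing {U T : A} (u : F.obj U) (f g : U ⟶ T) (h : F.map f u = F.map g u) :
    ∃ (V : A) (v : F.obj V) (p : V ⟶ U), F.map p v = u ∧ p ≫ f = p ≫ g := by
  obtain ⟨⟨V, v⟩, p, hp⟩ := IsCofilteredOrEmpty.cone_maps (C := F.Elements)
    (X := ⟨U, u⟩) (Y := ⟨T, F.map f u⟩) (CategoryOfElements.homMk _ _ f rfl)
    (CategoryOfElements.homMk _ _ g h.symm)
  exact ⟨V, v, p.1, p.2, congrArg Subtype.val hp⟩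

/-- Finitely many elements of `F` come from a single one. -/
theorem exists_common_of_finite {ι : Type*} [Finite ι] (T : ι → A) (x : ∀ i, F.obj (T i)) :
    ∃ (U : A) (u : F.obj U) (f : ∀ i, U ⟶ T i), ∀ i, F.map (f i) u = x i := by
  classical
  have := Fintype.ofFinite ι
  have key : ∀ s : Finset ι, ∃ (U : A) (u : F.obj U), ∀ i ∈ s, ∃ f : U ⟶ T i, F.map f u = x i := by
    intro s
    induction s using Finset.induction_on with
    | empty =>
      obtain ⟨⟨U, u⟩⟩ := IsCofiltered.nonempty (C := F.Elements)
      exact ⟨U, u, fun i hi => absurd hi (Finset.notMem_empty i)⟩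
    | insert i s hi ih =>
      obtain ⟨U, u, hu⟩ := ih
      obtain ⟨V, v, f, g, hf, hg⟩ := exists_common u (x i)
      refine ⟨V, v, fun j hj => ?_⟩
      rcases Finset.mem_insert.1 hj with rfl | hj
      · exact ⟨g, hg⟩
      · obtain ⟨q, hq⟩ := hu j hj
        exact ⟨f ≫ q, by rw [F.map_comp_apply, hf, hq]⟩
  obtain ⟨U, u, hu⟩ := key Finset.univ
  choose f hf using fun i => hu i (Finset.mem_univ i)
  exact ⟨U, u, f, hf⟩

/-- Every element `u` of `F` comes from an element `v` such that cells identified by `u` are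
already identified over `v`. -/
theorem exists_collapsing (H : X.IsDuality.{w} n) {U : A} (u : F.obj U) :
    ∃ (V : A) (v : F.obj V) (p : V ⟶ U), F.map p v = u ∧
      ∀ k, k ≤ n → ∀ x y : U ⟶ X.lin k, F.map x u = F.map y u → p ≫ x = p ≫ y := by
  classical
  have hfin : ∀ k : Set.Iic n, Finite (U ⟶ X.lin k) := fun k =>
    @Finite.of_equiv _ _ ((H.isFiniteDisk U).finite k k.2) Equiv.ulift
  have := Fintype.ofFinite (Σ k : Set.Iic n, (U ⟶ X.lin k) × (U ⟶ X.lin k))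
  have key : ∀ s : Finset (Σ k : Set.Iic n, (U ⟶ X.lin k) × (U ⟶ X.lin k)),
      ∃ (V : A) (v : F.obj V) (p : V ⟶ U), F.map p v = u ∧
        ∀ i ∈ s, F.map i.2.1 u = F.map i.2.2 u → p ≫ i.2.1 = p ≫ i.2.2 := by
    intro s
    induction s using Finset.induction_on with
    | empty => exact ⟨U, u, 𝟙 U, F.map_id_apply _ u, fun i hi => absurd hi (Finset.notMem_empty i)⟩
    | insert i s hi ih =>
      obtain ⟨V, v, p, rfl, h⟩ := ih
      by_cases he : F.map i.2.1 (F.map p v) = F.map i.2.2 (F.map p v)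
      · obtain ⟨V', v', q, rfl, hq⟩ := exists_equalizing v (p ≫ i.2.1) (p ≫ i.2.2)
          (by rw [F.map_comp_apply, F.map_comp_apply, he])
        refine ⟨V', v', q ≫ p, F.map_comp_apply _ _ _, fun j hj hj' => ?_⟩
        rcases Finset.mem_insert.1 hj with rfl | hj
        · rw [Category.assoc, Category.assoc, hq]
        · rw [Category.assoc, Category.assoc, h j hj hj']
      · refine ⟨V, v, p, rfl, fun j hj hj' => ?_⟩
        rcases Finset.mem_insert.1 hj with rfl | hj
        · exact absurd hj' he
        · exact h j hj hj'
  obtain ⟨V, v, p, hp, h⟩ := key Finset.univ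
  exact ⟨V, v, p, hp, fun k hk x y => h ⟨⟨k, hk⟩, x, y⟩ (Finset.mem_univ _)⟩

/-- The restriction of a filtered colimit of corepresentable functors is a disk, since the axioms
of a disk involve finitely many cells at a time. -/
theorem isDisk_restrict (H : X.IsDuality.{w} n) : ((X.restrict n).obj F).IsDisk := by
  have hN := fun U => (H.isFiniteDisk U).toIsDisk
  -- A single cell is the image of the identity.
  have lift : ∀ k (h : k ≤ n) (x : ((X.restrict n).obj F).cell k h),
      ∃ (U : A) (u : F.obj U) (c : (X.nerve.{w} n U).cell k h),
        DiskData.Hom.app (ofElement u) k h c = x := fun k h x =>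
    ⟨X.lin k, x, ⟨𝟙 _⟩, F.map_id_apply _ x⟩
  -- Two cells which are images of cells over `U`.
  have lift₂ : ∀ k (h : k ≤ n) (x y : ((X.restrict n).obj F).cell k h),
      ∃ (U : A) (u : F.obj U) (c d : (X.nerve.{w} n U).cell k h),
        DiskData.Hom.app (ofElement u) k h c = x ∧ DiskData.Hom.app (ofElement u) k h d = y := by
    intro k h x y
    obtain ⟨U, u, f, g, hf, hg⟩ := exists_common (F := F) (S := X.lin k) (T := X.lin k) x y
    exact ⟨U, u, ⟨f⟩, ⟨g⟩, hf, hg⟩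
  have lift_le : ∀ k (h : k < n) (x y : ((X.restrict n).obj F).cell (k + 1) h),
      ((X.restrict n).obj F).le k h x y → ∃ (U : A) (u : F.obj U)
        (c d : (X.nerve.{w} n U).cell (k + 1) h), (X.nerve.{w} n U).le k h c d ∧
        DiskData.Hom.app (ofElement u) _ h c = x ∧ DiskData.Hom.app (ofElement u) _ h d = y := by
    rintro k h _ _ ⟨z, rfl, rfl⟩
    exact ⟨X.fork k, z, ⟨X.deg₀ k⟩, ⟨X.deg₁ k⟩, ⟨⟨𝟙 _⟩, congrArg ULift.up (Category.id_comp _),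
      congrArg ULift.up (Category.id_comp _)⟩, rfl, rfl⟩
  have lift_le₂ : ∀ k (h : k < n) (x y x' y' : ((X.restrict n).obj F).cell (k + 1) h),
      ((X.restrict n).obj F).le k h x y → ((X.restrict n).obj F).le k h x' y' →
      ∃ (U : A) (u : F.obj U) (c d c' d' : (X.nerve.{w} n U).cell (k + 1) h),
        (X.nerve.{w} n U).le k h c d ∧ (X.nerve.{w} n U).le k h c' d' ∧
        DiskData.Hom.app (ofElement u) _ h c = x ∧ DiskData.Hom.app (ofElement u) _ h d = y ∧
        DiskData.Hom.app (ofElement u) _ h c' = x' ∧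
        DiskData.Hom.app (ofElement u) _ h d' = y' := by
    intro k h x y x' y' hxy hxy'
    obtain ⟨U, u, c, d, hcd, rfl, rfl⟩ := lift_le k h x y hxy
    obtain ⟨U', u', c', d', hcd', rfl, rfl⟩ := lift_le k h x' y' hxy'
    obtain ⟨V, v, f, g, rfl, rfl⟩ := exists_common u u'
    refine ⟨V, v, _, _, _, _, DiskData.Hom.app_le (X.nerveMap n f) k h _ _ hcd,
      DiskData.Hom.app_le (X.nerveMap n g) k h _ _ hcd', ?_, ?_, ?_, ?_⟩ <;>
      rw [← DiskData.comp_app, nerveMap_ofElement]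
  have collapse : ∀ (U : A) (u : F.obj U), ∃ (V : A) (v : F.obj V)
      (φ : X.nerve.{w} n U ⟶ X.nerve n V), φ ≫ ofElement v = ofElement u ∧
        ∀ k (h : k ≤ n) c d, DiskData.Hom.app (ofElement u) k h c =
          DiskData.Hom.app (ofElement u) k h d →
            DiskData.Hom.app φ k h c = DiskData.Hom.app φ k h d := by
    intro U u
    obtain ⟨V, v, p, rfl, hp⟩ := exists_collapsing H u
    exact ⟨V, v, X.nerveMap n p, nerveMap_ofElement p v, fun k h c d e =>
      congrArg ULift.up (hp k h c.down d.down e)⟩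
  exact
  { cell_zero := by
      obtain ⟨⟨U, u⟩⟩ := IsCofiltered.nonempty (C := F.Elements)
      obtain ⟨a⟩ := (hN U).cell_zero
      refine ⟨{ default := DiskData.Hom.app (ofElement u) 0 n.zero_le a.default
                uniq := fun x => ?_ }⟩
      obtain ⟨V, v, c, d, rfl, hd⟩ := lift₂ 0 n.zero_le x
        (DiskData.Hom.app (ofElement u) 0 n.zero_le a.default)
      obtain ⟨b⟩ := (hN V).cell_zero
      rw [← hd, b.uniq c, b.uniq d]
    i_s := fun k h x => by
      obtain ⟨U, u, c, rfl⟩ := lift _ _ x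
      rw [← DiskData.Hom.app_s, ← DiskData.Hom.app_i, (hN U).i_s]
    i_t := fun k h x => by
      obtain ⟨U, u, c, rfl⟩ := lift _ _ x
      rw [← DiskData.Hom.app_t, ← DiskData.Hom.app_i, (hN U).i_t]
    t_t := fun k h x => by
      obtain ⟨U, u, c, rfl⟩ := lift _ _ x
      rw [← DiskData.Hom.app_t, ← DiskData.Hom.app_t, ← DiskData.Hom.app_s, (hN U).t_t]
    t_s := fun k h x => by
      obtain ⟨U, u, c, rfl⟩ := lift _ _ x
      rw [← DiskData.Hom.app_s, ← DiskData.Hom.app_t, ← DiskData.Hom.app_s, (hN U).t_s]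
    le_fiber := fun k h x y hxy => by
      obtain ⟨U, u, c, d, hcd, rfl, rfl⟩ := lift_le k h x y hxy
      rw [← DiskData.Hom.app_i, ← DiskData.Hom.app_i, (hN U).le_fiber _ _ _ _ hcd]
    le_refl := fun k h x => by
      obtain ⟨U, u, c, rfl⟩ := lift _ _ x
      exact DiskData.Hom.app_le _ _ _ _ _ ((hN U).le_refl _ _ _)
    le_trans := fun k h x y z hxy hyz => by
      obtain ⟨U, u, c, d, c', d', hcd, hcd', rfl, hy, hy', rfl⟩ := lift_le₂ k h _ _ _ _ hxy hyz
      obtain ⟨V, v, φ, hφ, hφ'⟩ := collapse U u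
      rw [← hφ, DiskData.comp_app, DiskData.comp_app]
      refine DiskData.Hom.app_le _ _ _ _ _ ((hN V).le_trans _ _ _ (DiskData.Hom.app φ _ h d) _
        (DiskData.Hom.app_le _ _ _ _ _ hcd) ?_)
      rw [hφ' _ _ d c' (hy.trans hy'.symm)]
      exact DiskData.Hom.app_le _ _ _ _ _ hcd'
    le_antisymm := fun k h x y hxy hyx => by
      obtain ⟨U, u, c, d, c', d', hcd, hcd', hx, hy, hy', hx'⟩ := lift_le₂ k h _ _ _ _ hxy hyx
      obtain ⟨V, v, φ, hφ, hφ'⟩ := collapse U u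
      have h1 := DiskData.Hom.app_le φ _ _ _ _ hcd
      have h2 := DiskData.Hom.app_le φ _ _ _ _ hcd'
      rw [← hφ' _ _ d c' (hy.trans hy'.symm), ← hφ' _ _ c d' (hx.trans hx'.symm)] at h2
      rw [← hx, ← hy, ← hφ, DiskData.comp_app, DiskData.comp_app, (hN V).le_antisymm _ _ _ _ h1 h2]
    le_total := fun k h x y hxy => by
      obtain ⟨U, u, c, d, rfl, rfl⟩ := lift₂ _ _ x y
      obtain ⟨V, v, φ, hφ, hφ'⟩ := collapse U u
      rw [← DiskData.Hom.app_i, ← DiskData.Hom.app_i] at hxy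
      have := hφ' _ _ _ _ hxy
      rw [DiskData.Hom.app_i, DiskData.Hom.app_i] at this
      rw [← hφ, DiskData.comp_app, DiskData.comp_app]
      exact ((hN V).le_total _ _ _ _ this).imp (DiskData.Hom.app_le _ _ _ _ _)
        (DiskData.Hom.app_le _ _ _ _ _)
    s_le := by
      rintro k h _ y rfl
      obtain ⟨U, u, c, rfl⟩ := lift _ _ y
      rw [← DiskData.Hom.app_i, ← DiskData.Hom.app_s]
      exact DiskData.Hom.app_le _ _ _ _ _ ((hN U).s_le _ _ _ _ rfl)
    le_t := by
      rintro k h _ y rfl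
      obtain ⟨U, u, c, rfl⟩ := lift _ _ y
      rw [← DiskData.Hom.app_i, ← DiskData.Hom.app_t]
      exact DiskData.Hom.app_le _ _ _ _ _ ((hN U).le_t _ _ _ _ rfl)
    equalizer_zero := fun h => Set.eq_empty_of_forall_notMem fun x hx => by
      obtain ⟨U, u, c, rfl⟩ := lift _ _ x
      obtain ⟨V, v, φ, hφ, hφ'⟩ := collapse U u
      rw [Set.mem_ofPred_eq, ← DiskData.Hom.app_s, ← DiskData.Hom.app_t] at hx
      have := hφ' _ _ _ _ hx
      rw [DiskData.Hom.app_s, DiskData.Hom.app_t] at this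
      exact ((hN V).equalizer_zero h).subset this
    equalizer_succ := fun k h => by
      refine Set.Subset.antisymm (fun x hx => ?_) ?_
      · obtain ⟨U, u, c, rfl⟩ := lift _ _ x
        obtain ⟨V, v, φ, hφ, hφ'⟩ := collapse U u
        rw [Set.mem_ofPred_eq, ← DiskData.Hom.app_s, ← DiskData.Hom.app_t] at hx
        have := hφ' _ _ _ _ hx
        rw [DiskData.Hom.app_s, DiskData.Hom.app_t] at this
        rw [← hφ, DiskData.comp_app]
        refine (((hN V).equalizer_succ k h).subset this).imp ?_ ?_
        · rintro ⟨y, hy⟩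
          exact ⟨_, by rw [← hy, DiskData.Hom.app_s]⟩
        · rintro ⟨y, hy⟩
          exact ⟨_, by rw [← hy, DiskData.Hom.app_t]⟩
      · rintro _ (⟨x, rfl⟩ | ⟨x, rfl⟩) <;> obtain ⟨U, u, c, rfl⟩ := lift _ _ x
        · rw [Set.mem_ofPred_eq, ← DiskData.Hom.app_s, ← DiskData.Hom.app_s, ← DiskData.Hom.app_t,
            (hN U).t_s]
        · rw [Set.mem_ofPred_eq, ← DiskData.Hom.app_t, ← DiskData.Hom.app_s, ← DiskData.Hom.app_t,
            (hN U).t_t] }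

/-- Elements of `F` correspond to maps from nerves to the disk of `F`. Such a map involves finitely
many cells and finitely many relations between them, so it factors through `ofElement v` for some
element `v` of `F`; then the duality applies to the map of nerves obtained. -/
theorem ofElement_bijective (H : X.IsDuality.{w} n) (T : A) :
    Function.Bijective (ofElement (X := X) (n := n) (F := F) (T := T)) := by
  have hN := fun U => (H.isFiniteDisk U).toIsDisk
  have hR : ((X.restrict n).obj F).IsDisk := isDisk_restrict H
  constructor
  · intro x y hxy
    obtain ⟨U, u, f, g, rfl, rfl⟩ := exists_common x y
    obtain ⟨V, v, p, rfl, hp⟩ := exists_collapsing H u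
    have : p ≫ f = p ≫ g := H.faithful _ _ fun k hk c => by
      rw [Category.assoc, Category.assoc]
      refine hp k hk _ _ ?_
      rw [F.map_comp_apply, F.map_comp_apply]
      exact congrArg (fun q : X.nerve.{w} n T ⟶ (X.restrict n).obj F =>
        DiskData.Hom.app q k hk ⟨c⟩) hxy
    rw [← F.map_comp_apply, ← F.map_comp_apply, this]
  · intro φ
    have hfin : ∀ k : Set.Iic n, Finite (T ⟶ X.lin k) := fun k =>
      @Finite.of_equiv _ _ ((H.isFiniteDisk T).finite k k.2) Equiv.ulift
    obtain ⟨U, u, f, hf⟩ := exists_common_of_finite (F := F)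
      (ι := Σ k : Set.Iic n, (T ⟶ X.lin k)) (fun c => X.lin c.1)
      (fun c => DiskData.Hom.app φ c.1 c.1.2 ⟨c.2⟩)
    obtain ⟨V, v, p, rfl, hp⟩ := exists_collapsing H u
    let ψ : ∀ k (_ : k ≤ n), (X.nerve.{w} n T).cell k ‹_› → (X.nerve.{w} n V).cell k ‹_› :=
      fun k hk c => ⟨p ≫ f ⟨⟨k, hk⟩, c.down⟩⟩
    have hψ : ∀ k (hk : k ≤ n) c, DiskData.Hom.app (ofElement v) k hk (ψ k hk c) =
        DiskData.Hom.app φ k hk c := fun k hk c =>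
      (F.map_comp_apply _ _ _).trans (hf ⟨⟨k, hk⟩, c.down⟩)
    -- Cells of `V` coming from `U` are determined by their images.
    have hψ' : ∀ k (hk : k ≤ n) (c d : U ⟶ X.lin k),
        DiskData.Hom.app (ofElement (F := F) v) k hk ⟨p ≫ c⟩ =
          DiskData.Hom.app (ofElement (X := X) v) k hk ⟨p ≫ d⟩ →
        (⟨p ≫ c⟩ : ULift.{w} (V ⟶ X.lin k)) = ⟨p ≫ d⟩ := fun k hk c d h =>
      congrArg ULift.up (hp k hk c d (by
        rw [ofElement_app, ofElement_app, F.map_comp_apply, F.map_comp_apply] at h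
        exact h))
    have ψ_i : ∀ k (h : k < n) c, ψ k h.le ((X.nerve n T).i k h c) =
        (X.nerve n V).i k h (ψ (k + 1) h c) := fun k h c => by
      refine (hψ' k h.le _ (f ⟨⟨k + 1, h⟩, c.down⟩ ≫ X.proj k) ?_).trans
        (congrArg ULift.up (Category.assoc _ _ _).symm)
      refine (hψ k h.le _).trans (Eq.trans ?_ (congrArg (DiskData.Hom.app (ofElement v) k h.le)
        (congrArg ULift.up (Category.assoc p _ _))))
      refine (DiskData.Hom.app_i φ k h c).trans ?_
      rw [← hψ]
      exact (DiskData.Hom.app_i (ofElement v) k h _).symm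
    have ψ_s : ∀ k (h : k < n) c, ψ (k + 1) h ((X.nerve n T).s k h c) =
        (X.nerve n V).s k h (ψ k h.le c) := fun k h c => by
      refine (hψ' (k + 1) h _ (f ⟨⟨k, h.le⟩, c.down⟩ ≫ X.src k) ?_).trans
        (congrArg ULift.up (Category.assoc _ _ _).symm)
      refine (hψ (k + 1) h _).trans (Eq.trans ?_ (congrArg (DiskData.Hom.app (ofElement v) (k + 1) h)
        (congrArg ULift.up (Category.assoc p _ _))))
      refine (DiskData.Hom.app_s φ k h c).trans ?_
      rw [← hψ]
      exact (DiskData.Hom.app_s (ofElement v) k h _).symm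
    have ψ_t : ∀ k (h : k < n) c, ψ (k + 1) h ((X.nerve n T).t k h c) =
        (X.nerve n V).t k h (ψ k h.le c) := fun k h c => by
      refine (hψ' (k + 1) h _ (f ⟨⟨k, h.le⟩, c.down⟩ ≫ X.tgt k) ?_).trans
        (congrArg ULift.up (Category.assoc _ _ _).symm)
      refine (hψ (k + 1) h _).trans (Eq.trans ?_ (congrArg (DiskData.Hom.app (ofElement v) (k + 1) h)
        (congrArg ULift.up (Category.assoc p _ _))))
      refine (DiskData.Hom.app_t φ k h c).trans ?_
      rw [← hψ]
      exact (DiskData.Hom.app_t (ofElement v) k h _).symm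
    let Ψ : X.nerve.{w} n T ⟶ X.nerve n V := show DiskData.Hom _ _ from
      { app := ψ
        app_i := ψ_i
        app_s := ψ_s
        app_t := ψ_t
        app_le := fun k h c d hcd => by
          have hi : (X.nerve n V).i k h (ψ (k + 1) h c) = (X.nerve n V).i k h (ψ (k + 1) h d) := by
            rw [← ψ_i, ← ψ_i, (hN T).le_fiber _ _ _ _ hcd]
          rcases (hN V).le_total k h _ _ hi with h' | h'
          · exact h'
          · have h1 := DiskData.Hom.app_le φ _ _ _ _ hcd
            have h2 := DiskData.Hom.app_le (ofElement (F := F) v) _ _ _ _ h'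
            rw [hψ, hψ] at h2
            have e : ψ (k + 1) h c = ψ (k + 1) h d := hψ' _ h _ _
              ((hψ _ _ c).trans ((hR.le_antisymm _ _ _ _ h1 h2).trans (hψ _ _ d).symm))
            rw [e]
            exact (hN V).le_refl _ _ _ }
    obtain ⟨q, hq⟩ := H.full Ψ
    refine ⟨F.map q v, ?_⟩
    rw [← nerveMap_ofElement, hq]
    exact DiskData.hom_ext hψ

end Cofiltered

end DiskShape

/-! ### The flat functor of a disk -/

namespace DiskData

variable {n : ℕ} {D : DiskData.{w} n}

/-- The data induced by `D` on a family of sets of cells closed under `i`, `s` and `t`. -/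
def sub (D : DiskData.{w} n) (P : ∀ k (h : k ≤ n), Set (D.cell k h))
    (hi : ∀ k (h : k < n), ∀ x ∈ P (k + 1) h, D.i k h x ∈ P k h.le)
    (hs : ∀ k (h : k < n), ∀ x ∈ P k h.le, D.s k h x ∈ P (k + 1) h)
    (ht : ∀ k (h : k < n), ∀ x ∈ P k h.le, D.t k h x ∈ P (k + 1) h) : DiskData.{w} n where
  cell k h := P k h
  i k h x := ⟨D.i k h x, hi k h x x.2⟩
  s k h x := ⟨D.s k h x, hs k h x x.2⟩
  t k h x := ⟨D.t k h x, ht k h x x.2⟩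
  le k h x y := D.le k h x y

/-- The inclusion of a subfamily of cells. -/
def subι (P : ∀ k (h : k ≤ n), Set (D.cell k h)) (hi hs ht) : D.sub P hi hs ht ⟶ D :=
  show Hom _ _ from
  { app := fun _ _ => Subtype.val
    app_i := fun _ _ _ => rfl
    app_s := fun _ _ _ => rfl
    app_t := fun _ _ _ => rfl
    app_le := fun _ _ _ _ h => h }

theorem isDisk_sub (hD : D.IsDisk) (P : ∀ k (h : k ≤ n), Set (D.cell k h)) (hi hs ht)
    (h₀ : ∀ x, x ∈ P 0 n.zero_le) : (D.sub P hi hs ht).IsDisk where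
  cell_zero := by
    obtain ⟨u⟩ := hD.cell_zero
    exact ⟨{ default := ⟨u.default, h₀ _⟩, uniq := fun x => Subtype.ext (u.uniq _) }⟩
  i_s k h x := Subtype.ext (hD.i_s k h x.1)
  i_t k h x := Subtype.ext (hD.i_t k h x.1)
  t_t k h x := Subtype.ext (hD.t_t k h x.1)
  t_s k h x := Subtype.ext (hD.t_s k h x.1)
  le_fiber k h x y hxy := Subtype.ext (hD.le_fiber k h x.1 y.1 hxy)
  le_refl k h x := hD.le_refl k h x.1
  le_trans k h x y z := hD.le_trans k h x.1 y.1 z.1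
  le_antisymm k h x y hxy hyx := Subtype.ext (hD.le_antisymm k h x.1 y.1 hxy hyx)
  le_total k h x y hxy := hD.le_total k h x.1 y.1 (congrArg Subtype.val hxy)
  s_le k h x y hxy := hD.s_le k h x.1 y.1 (congrArg Subtype.val hxy)
  le_t k h x y hxy := hD.le_t k h x.1 y.1 (congrArg Subtype.val hxy)
  equalizer_zero h := Set.eq_empty_of_forall_notMem fun x hx =>
    (hD.equalizer_zero h).subset (congrArg Subtype.val hx : D.s 0 h x.1 = D.t 0 h x.1)
  equalizer_succ k h := by
    have hk := Nat.lt_of_succ_lt h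
    refine Set.Subset.antisymm (fun x hx => ?_) ?_
    · rcases (hD.equalizer_succ k h).subset
        (congrArg Subtype.val hx : D.s (k + 1) h x.1 = D.t (k + 1) h x.1) with ⟨y, hy⟩ | ⟨y, hy⟩
      · refine Or.inl ⟨⟨y, ?_⟩, Subtype.ext hy⟩
        rw [← hD.i_s k hk y, hy]
        exact hi k hk _ x.2
      · refine Or.inr ⟨⟨y, ?_⟩, Subtype.ext hy⟩
        rw [← hD.i_t k hk y, hy]
        exact hi k hk _ x.2
    · rintro _ (⟨x, rfl⟩ | ⟨x, rfl⟩)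
      · exact Subtype.ext (hD.t_s k h x.1).symm
      · exact Subtype.ext (hD.t_t k h x.1).symm

/-- The cells obtained from cells in `S` by repeated application of `i`. -/
inductive IsBelow (D : DiskData.{w} n) (S : ∀ k (h : k ≤ n), Set (D.cell k h)) :
    ∀ k (h : k ≤ n), D.cell k h → Prop
  | of (k : ℕ) (h : k ≤ n) (x : D.cell k h) : x ∈ S k h → IsBelow D S k h x
  | i (k : ℕ) (h : k < n) (x : D.cell (k + 1) h) :
      IsBelow D S (k + 1) h x → IsBelow D S k h.le (D.i k h x)

/-- Since `i` lowers the dimension, which is bounded by `n`, finitely many cells have finitely many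
cells below them. -/
theorem finite_isBelow {S : ∀ k (h : k ≤ n), Set (D.cell k h)} (hS : ∀ k h, (S k h).Finite) (k : ℕ)
    (h : k ≤ n) : {x | IsBelow D S k h x}.Finite := by
  obtain ⟨m, hm⟩ : ∃ m, n = k + m := ⟨n - k, (Nat.add_sub_cancel' h).symm⟩
  induction m generalizing k with
  | zero =>
    refine (hS k h).subset fun x hx => ?_
    cases hx with
    | of _ _ _ hx => exact hx
    | i k h' => exact absurd h' hm.le.not_gt
  | succ m ih =>
    have hk : k < n := hm ▸ Nat.lt_add_of_pos_right m.succ_pos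
    refine ((hS k h).union ((ih (k + 1) hk (by omega)).image (D.i k hk))).subset fun x hx => ?_
    cases hx with
    | of _ _ _ hx => exact Or.inl hx
    | i k h' y hy => exact Or.inr ⟨y, hy, rfl⟩

/-- The cells of the smallest subdisk containing `S`. -/
inductive IsGenerated (D : DiskData.{w} n) (S : ∀ k (h : k ≤ n), Set (D.cell k h)) :
    ∀ k (h : k ≤ n), D.cell k h → Prop
  | zero (x : D.cell 0 n.zero_le) : IsGenerated D S 0 n.zero_le x
  | of_isBelow (k : ℕ) (h : k ≤ n) (x : D.cell k h) : IsBelow D S k h x → IsGenerated D S k h x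
  | s (k : ℕ) (h : k < n) (x : D.cell k h.le) :
      IsGenerated D S k h.le x → IsGenerated D S (k + 1) h (D.s k h x)
  | t (k : ℕ) (h : k < n) (x : D.cell k h.le) :
      IsGenerated D S k h.le x → IsGenerated D S (k + 1) h (D.t k h x)

theorem finite_isGenerated (hD : D.IsDisk) {S : ∀ k (h : k ≤ n), Set (D.cell k h)}
    (hS : ∀ k h, (S k h).Finite) (k : ℕ) (h : k ≤ n) : {x | IsGenerated D S k h x}.Finite := by
  induction k with
  | zero =>
    obtain ⟨u⟩ := hD.cell_zero
    have := Finite.of_subsingleton (α := D.cell 0 h)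
    exact Set.toFinite _
  | succ k ih =>
    refine ((finite_isBelow hS (k + 1) h).union (((ih (Nat.le_of_succ_le h)).image (D.s k h)).union
      ((ih (Nat.le_of_succ_le h)).image (D.t k h)))).subset fun x hx => ?_
    cases hx with
    | of_isBelow _ _ _ hx => exact Or.inl hx
    | s _ _ y hy => exact Or.inr (Or.inl ⟨y, hy, rfl⟩)
    | t _ _ y hy => exact Or.inr (Or.inr ⟨y, hy, rfl⟩)

theorem IsGenerated.i (hD : D.IsDisk) {S : ∀ k (h : k ≤ n), Set (D.cell k h)} {k : ℕ} {h : k < n}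
    {x : D.cell (k + 1) h} (hx : IsGenerated D S (k + 1) h x) :
    IsGenerated D S k h.le (D.i k h x) := by
  cases hx with
  | of_isBelow _ _ _ hx => exact .of_isBelow _ _ _ (.i _ _ _ hx)
  | s _ _ y hy => rwa [hD.i_s]
  | t _ _ y hy => rwa [hD.i_t]

/-- A disk is the directed union of its finite subdisks. -/
theorem exists_finite_subdisk (hD : D.IsDisk) (S : ∀ k (h : k ≤ n), Set (D.cell k h))
    (hS : ∀ k h, (S k h).Finite) :
    ∃ (E : DiskData.{w} n) (φ : E ⟶ D), E.IsFiniteDisk ∧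
      (∀ k h, Function.Injective (Hom.app φ k h)) ∧ ∀ k h, S k h ⊆ Set.range (Hom.app φ k h) :=
  ⟨D.sub (fun k h => {x | IsGenerated D S k h x}) (fun _ _ _ => IsGenerated.i hD)
      (fun _ _ _ => .s _ _ _) (fun _ _ _ => .t _ _ _), subι _ _ _ _,
    { __ := isDisk_sub hD _ _ _ _ .zero
      finite := fun k h => finite_isGenerated hD hS k h },
    fun _ _ => Subtype.val_injective,
    fun _ _ x hx => ⟨⟨x, .of_isBelow _ _ _ (.of _ _ _ hx)⟩, rfl⟩⟩

/-- A map into a disk whose values lie in a subdisk factors through it. -/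
theorem exists_factorization {E W : DiskData.{w} n} (hW : W.IsDisk) (hE : E.IsDisk) (m : W ⟶ E)
    (hm : ∀ k h, Function.Injective (Hom.app m k h)) (ψ : D ⟶ E)
    (hψ : ∀ k h x, Hom.app ψ k h x ∈ Set.range (Hom.app m k h)) : ∃ χ : D ⟶ W, χ ≫ m = ψ := by
  choose g hg using hψ
  refine ⟨show Hom _ _ from
    { app := g
      app_i := fun k h x => hm _ _ (by rw [hg, Hom.app_i, Hom.app_i, hg])
      app_s := fun k h x => hm _ _ (by rw [hg, Hom.app_s, Hom.app_s, hg])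
      app_t := fun k h x => hm _ _ (by rw [hg, Hom.app_t, Hom.app_t, hg])
      app_le := fun k h x y hxy => le_of_app_le hW hE m hm _ _ _ _ (by
        rw [hg, hg]
        exact Hom.app_le ψ _ _ _ _ hxy) }, hom_ext hg⟩

end DiskData

namespace DiskShape

variable {A : Type} [SmallCategory A] {X : DiskShape A} {n : ℕ}

theorem nerveMap_id (T : A) : X.nerveMap.{w} n (𝟙 T) = 𝟙 _ :=
  DiskData.hom_ext fun _ _ _ => congrArg ULift.up (Category.id_comp _)

theorem nerveMap_comp {S T U : A} (f : S ⟶ T) (g : T ⟶ U) :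
    X.nerveMap.{w} n (f ≫ g) = X.nerveMap n g ≫ X.nerveMap n f :=
  DiskData.hom_ext fun _ _ _ => congrArg ULift.up (Category.assoc _ _ _)

variable (X) in
/-- The functor of maps from nerves to `D`. When the shape is a duality and `D` is a disk, its
elements are the finite disks over `D`, and it is the flat functor corresponding to `D`. -/
def homNerve (D : DiskData.{w} n) : A ⥤ Type w where
  obj T := X.nerve.{w} n T ⟶ D
  map f := ↾fun φ => X.nerveMap n f ≫ φ
  map_id T := by
    ext φ
    simp [nerveMap_id]
  map_comp f g := by
    ext φ
    simp [nerveMap_comp]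

variable {D : DiskData.{w} n}

/-- By duality, finitely many cells of a disk lie in a subdisk which is a nerve. -/
theorem exists_nerve_of_finite (H : X.IsDuality.{w} n) (hD : D.IsDisk)
    (S : ∀ k (h : k ≤ n), Set (D.cell k h)) (hS : ∀ k h, (S k h).Finite) :
    ∃ (T : A) (φ : X.nerve.{w} n T ⟶ D), (∀ k h, Function.Injective (DiskData.Hom.app φ k h)) ∧
      ∀ k h, S k h ⊆ Set.range (DiskData.Hom.app φ k h) := by
  obtain ⟨E, φ, hE, hφ, hφS⟩ := DiskData.exists_finite_subdisk hD S hS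
  obtain ⟨T, ⟨e⟩⟩ := H.essSurj E hE
  refine ⟨T, e.hom ≫ φ, fun k h => (hφ k h).comp (Function.LeftInverse.injective
    (g := DiskData.Hom.app e.inv k h) (DiskData.hom_inv_app e k h)), fun k h x hx => ?_⟩
  obtain ⟨y, rfl⟩ := hφS k h hx
  exact ⟨DiskData.Hom.app e.inv k h y, congrArg _ (DiskData.inv_hom_app e k h y)⟩

theorem exists_eq_nerveMap_comp (H : X.IsDuality.{w} n) (hD : D.IsDisk) {U T : A}
    (χ : X.nerve.{w} n U ⟶ D) (hχ : ∀ k h, Function.Injective (DiskData.Hom.app χ k h))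
    (φ : X.nerve.{w} n T ⟶ D)
    (hφ : ∀ k h x, DiskData.Hom.app φ k h x ∈ Set.range (DiskData.Hom.app χ k h)) :
    ∃ f : U ⟶ T, X.nerveMap n f ≫ χ = φ := by
  obtain ⟨ψ, rfl⟩ := DiskData.exists_factorization (H.isFiniteDisk U).toIsDisk hD χ hχ φ hφ
  obtain ⟨f, rfl⟩ := H.full ψ
  exact ⟨f, rfl⟩

/-- Any two maps from nerves to a disk factor through a common subdisk. -/
theorem exists_common_nerve (H : X.IsDuality.{w} n) (hD : D.IsDisk) {S T : A}
    (φ : X.nerve.{w} n S ⟶ D) (ψ : X.nerve.{w} n T ⟶ D) :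
    ∃ (U : A) (χ : X.nerve.{w} n U ⟶ D) (f : U ⟶ S) (g : U ⟶ T),
      (∀ k h, Function.Injective (DiskData.Hom.app χ k h)) ∧
      X.nerveMap n f ≫ χ = φ ∧ X.nerveMap n g ≫ χ = ψ := by
  have hfin := fun T => (H.isFiniteDisk T).finite
  obtain ⟨U, χ, hχ, hχS⟩ := exists_nerve_of_finite H hD
    (fun k h => Set.range (DiskData.Hom.app φ k h) ∪ Set.range (DiskData.Hom.app ψ k h))
    (fun k h => (Set.finite_range _).union (Set.finite_range _))
  obtain ⟨f, hf⟩ := exists_eq_nerveMap_comp H hD χ hχ φ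
    fun k h x => hχS k h (Or.inl ⟨x, rfl⟩)
  obtain ⟨g, hg⟩ := exists_eq_nerveMap_comp H hD χ hχ ψ
    fun k h x => hχS k h (Or.inr ⟨x, rfl⟩)
  exact ⟨U, χ, f, g, hχ, hf, hg⟩

/-- Subdisks separate operators. -/
theorem eq_of_nerveMap_comp (H : X.IsDuality.{w} n) {U T : A}
    (χ : X.nerve.{w} n U ⟶ D) (hχ : ∀ k h, Function.Injective (DiskData.Hom.app χ k h))
    {f g : U ⟶ T} (hfg : X.nerveMap n f ≫ χ = X.nerveMap n g ≫ χ) : f = g :=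
  H.faithful f g fun k hk c => congrArg ULift.down (hχ k hk
    (congrArg (fun q : X.nerve.{w} n T ⟶ D => DiskData.Hom.app q k hk ⟨c⟩) hfg))

/-- Two maps from nerves to `D` factor through a common subdisk, on which parallel operators
agree as soon as they agree in `D`. -/
theorem isCofiltered_homNerve (H : X.IsDuality.{w} n) (hD : D.IsDisk) :
    IsCofiltered (X.homNerve D).Elements where
  nonempty := by
    obtain ⟨T, φ, -⟩ := exists_nerve_of_finite H hD (fun _ _ => ∅) fun _ _ => Set.finite_empty
    exact ⟨⟨T, φ⟩⟩
  cone_objs := by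
    rintro ⟨S, φ⟩ ⟨T, ψ⟩
    obtain ⟨U, χ, f, g, -, hf, hg⟩ := exists_common_nerve H hD φ ψ
    exact ⟨⟨U, χ⟩, CategoryOfElements.homMk _ _ f hf, CategoryOfElements.homMk _ _ g hg, trivial⟩
  cone_maps := by
    rintro ⟨S, φ⟩ ⟨T, ψ⟩ f g
    obtain ⟨U, χ, p, -, hχ, hp, -⟩ := exists_common_nerve H hD φ φ
    refine ⟨⟨U, χ⟩, CategoryOfElements.homMk _ _ p hp, Subtype.ext
      (eq_of_nerveMap_comp H χ hχ ?_)⟩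
    have hf : X.nerveMap n f.1 ≫ φ = ψ := f.2
    have hg : X.nerveMap n g.1 ≫ φ = ψ := g.2
    change X.nerveMap n (p ≫ f.1) ≫ χ = X.nerveMap n (p ≫ g.1) ≫ χ
    have hp' : X.nerveMap n p ≫ χ = φ := hp
    rw [nerveMap_comp, nerveMap_comp, Category.assoc, Category.assoc, hp', hf, hg]

variable (X) in
/-- Evaluation at the identities: a map `X.nerve n (X.lin k) ⟶ D` determines a cell of `D` of
dimension `k`. -/
def evalId (D : DiskData.{w} n) : (X.restrict n).obj (X.homNerve D) ⟶ D :=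
  have key : ∀ {k} {h : k ≤ n} {T : A} (f : T ⟶ X.lin k) (φ : X.nerve.{w} n T ⟶ D),
      DiskData.Hom.app (X.nerveMap n f ≫ φ) k h ⟨𝟙 _⟩ = DiskData.Hom.app φ k h ⟨f⟩ :=
    fun f φ => congrArg (fun c => DiskData.Hom.app φ _ _ ⟨c⟩) (Category.comp_id f)
  show DiskData.Hom _ _ from
  { app := fun k h φ => DiskData.Hom.app (D := X.nerve n (X.lin k)) φ k h ⟨𝟙 _⟩
    app_i := fun k h φ => by
      refine (key (X.proj k) φ).trans (Eq.trans ?_ (DiskData.Hom.app_i φ k h ⟨𝟙 _⟩))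
      exact congrArg (fun c => DiskData.Hom.app φ k h.le ⟨c⟩) (Category.id_comp _).symm
    app_s := fun k h φ => by
      refine (key (X.src k) φ).trans (Eq.trans ?_ (DiskData.Hom.app_s φ k h ⟨𝟙 _⟩))
      exact congrArg (fun c => DiskData.Hom.app φ (k + 1) h ⟨c⟩) (Category.id_comp _).symm
    app_t := fun k h φ => by
      refine (key (X.tgt k) φ).trans (Eq.trans ?_ (DiskData.Hom.app_t φ k h ⟨𝟙 _⟩))
      exact congrArg (fun c => DiskData.Hom.app φ (k + 1) h ⟨c⟩) (Category.id_comp _).symm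
    app_le := by
      rintro k h _ _ ⟨φ, rfl, rfl⟩
      refine (congrArg₂ (D.le k h) (key (X.deg₀ k) φ) (key (X.deg₁ k) φ)).mpr ?_
      exact DiskData.Hom.app_le φ k h _ _
        ⟨⟨𝟙 _⟩, congrArg ULift.up (Category.id_comp _), congrArg ULift.up (Category.id_comp _)⟩ }

theorem evalId_app_nerveMap {k : ℕ} {h : k ≤ n} {T : A} (f : T ⟶ X.lin k)
    (φ : X.nerve.{w} n T ⟶ D) :
    DiskData.Hom.app (X.evalId D) k h (X.nerveMap n f ≫ φ : X.nerve.{w} n (X.lin k) ⟶ D) =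
      DiskData.Hom.app φ k h ⟨f⟩ :=
  congrArg (fun c => DiskData.Hom.app φ _ _ ⟨c⟩) (Category.comp_id f)

/-- Every cell of a disk `D` lies in a subdisk which is a nerve, where it is represented by an
operator into the shape. -/
theorem isIso_evalId (H : X.IsDuality.{w} n) (hD : D.IsDisk) : IsIso (X.evalId D) := by
  have := isCofiltered_homNerve H hD
  have hbij : ∀ k (h : k ≤ n), Function.Bijective (DiskData.Hom.app (X.evalId D) k h) := by
    intro k h
    constructor
    · intro φ ψ hφψ
      obtain ⟨U, χ, f, g, hχ, rfl, rfl⟩ := exists_common_nerve H hD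
        (φ : X.nerve.{w} n (X.lin k) ⟶ D) (ψ : X.nerve.{w} n (X.lin k) ⟶ D)
      rw [evalId_app_nerveMap, evalId_app_nerveMap] at hφψ
      rw [ULift.up_injective (hχ k h hφψ)]
    · intro x
      obtain ⟨U, χ, -, hx⟩ := exists_nerve_of_finite H hD
        (fun j hj => Sigma.mk (β := fun j : Set.Iic n => D.cell j j.2) ⟨j, hj⟩ ⁻¹' {⟨⟨k, h⟩, x⟩})
        fun j hj => Set.Finite.preimage sigma_mk_injective.injOn (Set.finite_singleton _)
      obtain ⟨⟨c⟩, rfl⟩ := hx k h rfl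
      exact ⟨_, evalId_app_nerveMap c χ⟩
  exact DiskData.isIso_of_bijective _ hbij (DiskData.le_of_app_le (isDisk_restrict H) hD _
    fun k h => (hbij k h).1)

/-- Between flat functors, a map of the restrictions extends uniquely to a transformation. -/
theorem restrict_map_bijective (H : X.IsDuality.{w} n) {F G : A ⥤ Type w} [IsCofiltered F.Elements]
    [IsCofiltered G.Elements] :
    Function.Bijective ((X.restrict n).map : (F ⟶ G) → _) := by
  constructor
  · intro α β h
    ext T x
    apply (ofElement_bijective (F := G) H T).1
    change ofElement (α.app T x) = ofElement (β.app T x)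
    rw [← ofElement_map, ← ofElement_map, h]
  · intro g
    choose a ha using fun T (x : F.obj T) =>
      (ofElement_bijective (F := G) H T).2 (ofElement x ≫ g)
    refine ⟨{ app := fun T => ↾(a T), naturality := fun S T f => ?_ }, ?_⟩
    · ext x
      apply (ofElement_bijective (F := G) H T).1
      change ofElement (a T (F.map f x)) = ofElement (G.map f (a S x))
      rw [ha, ← nerveMap_ofElement, ← nerveMap_ofElement, ha, Category.assoc]
    · refine DiskData.hom_ext fun k h x => ?_
      have := congrArg (fun q : X.nerve.{w} n (X.lin k) ⟶ (X.restrict n).obj G =>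
        DiskData.Hom.app q k h ⟨𝟙 _⟩) (ha (X.lin k) x)
      refine ((G.map_id_apply _ _).symm.trans this).trans ?_
      exact congrArg (DiskData.Hom.app g k h) (F.map_id_apply _ _)

end DiskShape

/-! ### Classification of disks -/

theorem mainTheorem3 (n : ℕ) (hn : 1 ≤ n) :
    (∃ h : ∀ F : FlatTheta.{w} n, ((restrictLin n).obj F.obj).IsDisk,
      (ObjectProperty.lift DiskData.IsDisk.{w}
        (ObjectProperty.ι (fun F : Theta n ⥤ Type w => IsFlat F) ⋙ restrictLin n) h :
          FlatTheta.{w} n ⥤ CombDisk.{w} n).IsEquivalence) ∧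
    (∃ h : ∀ T : (Theta n)ᵒᵖ, ((restrictLin n).obj (uliftCoyoneda.{w}.obj T)).IsFiniteDisk,
      IsSkeletonOf (FinCombDisk.{w} n) (Theta n)ᵒᵖ
        (ObjectProperty.lift DiskData.IsFiniteDisk.{w} (uliftCoyoneda.{w} ⋙ restrictLin n) h)) := by
  have H := Theta.isDuality_shape.{w} n
  -- Makes the elements of a flat functor cofiltered by instance search below.
  have hF : ∀ F : FlatTheta.{w} n, IsCofiltered F.obj.Elements := fun F => F.property.isCofiltered
  rw [DiskShape.restrict_shape]
  refine ⟨⟨fun F => DiskShape.isDisk_restrict H, ?_⟩, ⟨fun T => H.isFiniteDisk T.unop, ?_⟩⟩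
  · refine { faithful := ⟨fun {F G α β} h => ?_⟩, full := ⟨fun {F G} g => ?_⟩,
             essSurj := ⟨fun D => ?_⟩ }
    · have h' := congrArg InducedCategory.Hom.hom h
      exact ObjectProperty.hom_ext _ ((DiskShape.restrict_map_bijective H).1 h')
    · obtain ⟨α, hα⟩ := (DiskShape.restrict_map_bijective (F := F.obj) (G := G.obj) H).2 g.hom
      exact ⟨ObjectProperty.homMk α, ObjectProperty.hom_ext _ hα⟩
    · have := DiskShape.isIso_evalId H D.property
      exact ⟨⟨(Theta.shape n).homNerve D.obj,
        isFlat_of_isCofiltered (DiskShape.isCofiltered_homNerve H D.property)⟩,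
        ⟨ObjectProperty.isoMk _ (asIso ((Theta.shape n).evalId D.obj))⟩⟩
  · refine { skel := ?_, eqv := { faithful := ⟨fun {S T f g} h => ?_⟩,
                                  full := ⟨fun {S T} g => ?_⟩, essSurj := ⟨fun D => ?_⟩ } }
    · rintro S T ⟨e⟩
      exact Opposite.unop_injective (Theta.skeletal n ⟨e.unop.symm⟩)
    · have h' := congrArg InducedCategory.Hom.hom h
      exact Quiver.Hom.unop_inj (H.faithful _ _ fun k hk c => congrArg
        (fun q : (Theta.shape n).nerve.{w} n S.unop ⟶ (Theta.shape n).nerve n T.unop =>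
          (DiskData.Hom.app q k hk ⟨c⟩).down) h')
    · obtain ⟨f, hf⟩ := H.full g.hom
      exact ⟨f.op, ObjectProperty.hom_ext _ hf⟩
    · obtain ⟨T, ⟨e⟩⟩ := H.essSurj D.obj D.property
      exact ⟨Opposite.op T, ⟨ObjectProperty.isoMk _ e⟩⟩
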